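/- Let $F_2=\langle a,b\rangle$ and a second copy of it $\langle c,d\rangle$ be amalgamated along $F_1=\langle h\rangle\cong\mathbb Z$, where $h=aba^{-1}b^{-1}=cdc^{-1}d^{-1}$, and let $G=F_2*_{F_1}F_2$, so that $L(F_2)*_{L(F_1)}L(F_2)=L(G)$, the von Neumann algebra generated by the left regular representation of $G$ on $\ell^2(G)$. Let $\tau(T)=\langle T\delta_e,\delta_e\rangle$ be its canonical trace and $E:L(G)\to L(F_1)$, $E\big(\sum_g t_g g\big)=\sum_{g\in F_1}t_g g$, the conditional expectation. Put $x=a+b+a^{-1}+b^{-1}$ and $y=c+d+c^{-1}+d^{-1}$. Then $$\tau\big((x+y)^8\big)=\tau\big(E((x+y)^8)\big)=44264 .$$ Moreover this number is given by each of the following two computations. (1) Let $NC(8)$ be the lattice of noncrossing partitions of $\{1,\dots,8\}$ ordered by refinement, $\mu$ its Möbius function, $NC^{(even)}(8)$ the set of noncrossing partitions all of whose blocks have even size, and $|\theta|$ the number of blocks of $\theta$. For $\pi\in NC(8)$ let $\Psi_x(\pi)=\widehat E(\pi)(x\otimes\cdots\otimes x)\in L(F_1)$ be the nested $E$-moment: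 each block of $\pi$ contributes $E$ of the product of its factors $x$, with the contributions of the blocks nested inside it inserted in their places (for example $\{\{1,4\},\{2,3\},\{5,6\},\{7,8\}\}$ gives $E(xE(x^2)x)\,E(x^2)\,E(x^2)$). Then $$\sum_{\theta\in NC^{(even)}(8)}2^{|\theta|}\sum_{\substack{\pi\in NC^{(even)}(8)\\ \pi\le\theta}}\mu(\pi,\theta)\,\tau\big(\Psi_x(\pi)\big)=44264 .$$ (2) Let $F_4$ be the free group on four generators, $\tau_4$ the canonical trace of $L(F_4)$, and $X_1\in L(F_4)$ the sum of the four generators and their inverses. Then $\tau_4(X_1^8)=44248$. There are exactly $16$ words of length $8$ in $a^{\pm1},b^{\pm1},c^{\pm1},d^{\pm1}$ that represent the identity of $G$ but not the identity of the free group on $a,b,c,d$: they are the cyclic rotations of the surface relator $aba^{-1}b^{-1}dcd^{-1}c^{-1}$ and of its inverse. Hence $\tau((x+y)^8)=\tau_4(X_1^8)+16=44248+16=44264$. -/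

import Mathlib

noncomputable section

namespace FreeAmalgam

/-- The Hilbert space `ℓ²(Γ)`. -/
abbrev L2 (Γ : Type*) : Type _ := lp (fun _ : Γ => ℂ) 2

open scoped Classical in
/-- The point mass `δ_g ∈ ℓ²(Γ)`. -/
def delta {Γ : Type*} (g : Γ) : L2 Γ := lp.single 2 g 1

theorem norm_sq_eq {Γ : Type*} (f : L2 Γ) : ‖f‖ ^ 2 = ∑' t, ‖f t‖ ^ 2 := by
  have := lp.norm_rpow_eq_tsum (p := 2) (by norm_num) f
  simpa using this

theorem summable_sq {Γ : Type*} (f : L2 Γ) : Summable fun t => ‖f t‖ ^ 2 := by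
  have := (lp.memℓp f).summable (by norm_num)
  simpa using this

theorem memℓp_two_of_le {Γ : Type*} {f : Γ → ℂ} {C : ℝ}
    (h : ∀ s : Finset Γ, ∑ t ∈ s, ‖f t‖ ^ 2 ≤ C) : Memℓp f 2 :=
  memℓp_gen' (C := C) (by simpa using h)

theorem norm_le_of_sum_le {Γ : Type*} (f : L2 Γ) {C : ℝ} (hC : 0 ≤ C)
    (h : ∀ s : Finset Γ, ∑ t ∈ s, ‖f t‖ ^ 2 ≤ C ^ 2) : ‖f‖ ≤ C :=
  lp.norm_le_of_forall_sum_le (by norm_num) hC (by simpa using h)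

theorem memℓp_comp_perm {Γ : Type*} (σ : Equiv.Perm Γ) (f : L2 Γ) :
    Memℓp (fun t => f (σ.symm t)) 2 := by
  refine memℓp_gen ?_
  have := (σ.symm.summable_iff).2 (summable_sq f)
  simpa [Function.comp_def] using this

/-- The unitary `f ↦ f ∘ σ⁻¹` of `ℓ²(Γ)` given by a permutation `σ` of `Γ`; it maps `δ_t` to
`δ_{σ t}`. -/
def permOp {Γ : Type*} (σ : Equiv.Perm Γ) : L2 Γ →L[ℂ] L2 Γ :=
  LinearMap.mkContinuous
    { toFun := fun f => ⟨fun t => f (σ.symm t), memℓp_comp_perm σ f⟩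
      map_add' := fun _ _ => rfl
      map_smul' := fun _ _ => rfl } 1 (fun f => by
        rw [one_mul]
        refine le_of_sq_le_sq (le_of_eq ?_) (norm_nonneg _)
        rw [norm_sq_eq, norm_sq_eq]
        exact σ.symm.tsum_eq (fun t => ‖f t‖ ^ 2))

/-- The left regular representation: `(λ(g) f)(t) = f(g⁻¹ t)`, so that `λ(g) δ_t = δ_{gt}`. -/
def lam {Γ : Type*} [Group Γ] (g : Γ) : L2 Γ →L[ℂ] L2 Γ := permOp (Equiv.mulLeft g)

theorem permOp_apply {Γ : Type*} (σ : Equiv.Perm Γ) (f : L2 Γ) (t : Γ) :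
    permOp σ f t = f (σ.symm t) := rfl

theorem lam_apply {Γ : Type*} [Group Γ] (g : Γ) (f : L2 Γ) (t : Γ) :
    lam g f t = f (g⁻¹ * t) := rfl

/-- The von Neumann algebra `λ(K)''` on `ℓ²(Γ)` generated by the left translations by the elements
of the subgroup `K`. -/
def subgroupVN {Γ : Type*} [Group Γ] (K : Subgroup Γ) : VonNeumannAlgebra (L2 Γ) where
  toStarSubalgebra := StarSubalgebra.centralizer ℂ
    (StarSubalgebra.centralizer ℂ (lam '' (K : Set Γ)) : Set (L2 Γ →L[ℂ] L2 Γ))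
  centralizer_centralizer' := by simp

/-- The group von Neumann algebra `L(Γ) = λ(Γ)''`. -/
abbrev groupVN (Γ : Type*) [Group Γ] : VonNeumannAlgebra (L2 Γ) := subgroupVN ⊤

instance vnSMulMemClass {H : Type*} [NormedAddCommGroup H] [InnerProductSpace ℂ H]
    [CompleteSpace H] : SMulMemClass (VonNeumannAlgebra H) ℂ (H →L[ℂ] H) where
  smul_mem {S} c _ h := S.toStarSubalgebra.smul_mem h c

theorem lam_mem {Γ : Type*} [Group Γ] {K : Subgroup Γ} {g : Γ} (hg : g ∈ K) :
    lam g ∈ subgroupVN K := by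
  change lam g ∈ StarSubalgebra.centralizer ℂ _
  rw [StarSubalgebra.mem_centralizer_iff]
  intro S hS
  have h1 := (StarSubalgebra.mem_centralizer_iff ℂ).1 hS (lam g) ⟨g, hg, rfl⟩
  have h2 := (StarSubalgebra.mem_centralizer_iff ℂ).1 (star_mem hS) (lam g) ⟨g, hg, rfl⟩
  exact ⟨h1.1.symm, h2.1.symm⟩

/-- The canonical unitary of `L(Γ)` given by `g ∈ Γ`. -/
def unit {Γ : Type*} [Group Γ] (g : Γ) : groupVN Γ := ⟨lam g, lam_mem (Subgroup.mem_top g)⟩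

/-- The canonical trace `τ(T) = ⟨δ_e, T δ_e⟩` on `L(Γ)`, that is, the coefficient of `e`. -/
def trace {Γ : Type*} [Group Γ] (T : groupVN Γ) : ℂ :=
  inner ℂ (delta (1 : Γ)) ((T : L2 Γ →L[ℂ] L2 Γ) (delta 1))

/-! ### The conditional expectation -/

open scoped Classical in
theorem memℓp_indicator {Γ : Type*} (S : Set Γ) (f : L2 Γ) :
    Memℓp (fun t => if t ∈ S then f t else 0) 2 := by
  refine memℓp_two_of_le (C := ‖f‖ ^ 2) fun F => ?_
  rw [norm_sq_eq]
  refine le_trans (Finset.sum_le_sum fun t _ => ?_)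
    ((summable_sq f).sum_le_tsum F fun t _ => by positivity)
  split_ifs <;> simp

open scoped Classical in
/-- The orthogonal projection of `ℓ²(Γ)` onto `ℓ²(S)`. -/
def cutOff {Γ : Type*} (S : Set Γ) : L2 Γ →ₗ[ℂ] L2 Γ where
  toFun f := ⟨fun t => if t ∈ S then f t else 0, memℓp_indicator S f⟩
  map_add' f g := by
    ext t
    change (if t ∈ S then f t + g t else 0) = (if t ∈ S then f t else 0) + (if t ∈ S then g t else 0)
    split_ifs <;> simp
  map_smul' c f := by
    ext t
    by_cases h : t ∈ S <;> simp [h]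

open scoped Classical in
theorem cutOff_apply {Γ : Type*} (S : Set Γ) (f : L2 Γ) (t : Γ) :
    cutOff S f t = if t ∈ S then f t else 0 := rfl

open scoped Classical in
theorem sum_block_le {Γ Q : Type*} (c : Γ → Q) (T : L2 Γ →L[ℂ] L2 Γ) (f : L2 Γ) (F : Finset Γ) :
    ∑ s ∈ F, ‖T (cutOff (c ⁻¹' {c s}) f) s‖ ^ 2 ≤ (‖T‖ * ‖f‖) ^ 2 := by
  have hmaps : ∀ s ∈ F, c s ∈ F.image c := fun s hs => Finset.mem_image_of_mem c hs
  rw [← Finset.sum_fiberwise_of_maps_to hmaps]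
  have h1 : ∀ q ∈ F.image c, ∑ s ∈ F with c s = q, ‖T (cutOff (c ⁻¹' {c s}) f) s‖ ^ 2 ≤
      ‖T‖ ^ 2 * ‖cutOff (c ⁻¹' {q}) f‖ ^ 2 := by
    intro q _
    have h2 : ∑ s ∈ F with c s = q, ‖T (cutOff (c ⁻¹' {c s}) f) s‖ ^ 2 =
        ∑ s ∈ F with c s = q, ‖T (cutOff (c ⁻¹' {q}) f) s‖ ^ 2 := by
      refine Finset.sum_congr rfl fun s hs => ?_
      rw [(Finset.mem_filter.1 hs).2]
    rw [h2, ← mul_pow]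
    refine le_trans ((summable_sq _).sum_le_tsum _ fun t _ => by positivity) ?_
    rw [← norm_sq_eq]
    exact pow_le_pow_left₀ (norm_nonneg _) (T.le_opNorm _) 2
  refine le_trans (Finset.sum_le_sum h1) ?_
  rw [← Finset.mul_sum, mul_pow]
  refine mul_le_mul_of_nonneg_left ?_ (by positivity)
  simp_rw [norm_sq_eq]
  rw [← Summable.tsum_finsetSum fun q _ => summable_sq _]
  refine Summable.tsum_le_tsum (fun t => ?_) (summable_sum fun q _ => summable_sq _)
    (summable_sq f)
  have h3 : ∀ q, ‖cutOff (c ⁻¹' {q}) f t‖ ^ 2 = if q = c t then ‖f t‖ ^ 2 else 0 := by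
    intro q
    rw [cutOff_apply]
    by_cases h : q = c t
    · simp [h]
    · have : c t ≠ q := fun h' => h h'.symm
      simp [h, this]
  simp_rw [h3]
  rw [Finset.sum_ite_eq']
  split_ifs
  · exact le_rfl
  · positivity

/-- The block diagonal part of an operator `T` on `ℓ²(Γ)`, for the partition of `Γ` into the fibres
of a map `c`: the matrix entry of `T` at `(s, t)` is kept if `c s = c t` and replaced by `0`
otherwise. -/
def blockDiag {Γ Q : Type*} (c : Γ → Q) : (L2 Γ →L[ℂ] L2 Γ) →ₗ[ℂ] (L2 Γ →L[ℂ] L2 Γ) where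
  toFun T := LinearMap.mkContinuous
    { toFun := fun f => ⟨fun s => T (cutOff (c ⁻¹' {c s}) f) s,
        memℓp_two_of_le (sum_block_le c T f)⟩
      map_add' := fun f g => by
        ext s
        change T (cutOff (c ⁻¹' {c s}) (f + g)) s = _
        rw [map_add, map_add]
        rfl
      map_smul' := fun a f => by
        ext s
        change T (cutOff (c ⁻¹' {c s}) (a • f)) s = _
        rw [map_smul, map_smul]
        rfl } ‖T‖ (fun f => norm_le_of_sum_le _ (by positivity) (sum_block_le c T f))
  map_add' _ _ := rfl
  map_smul' _ _ := rfl

theorem blockDiag_apply {Γ Q : Type*} (c : Γ → Q) (T : L2 Γ →L[ℂ] L2 Γ) (f : L2 Γ) (s : Γ) :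
    blockDiag c T f s = T (cutOff (c ⁻¹' {c s}) f) s := rfl

theorem delta_apply {Γ : Type*} [DecidableEq Γ] (g t : Γ) :
    delta g t = if t = g then 1 else 0 := by
  by_cases h : t = g
  · subst h
    simp [delta]
  · simp [delta, h]

theorem inner_delta {Γ : Type*} (s : Γ) (f : L2 Γ) : inner ℂ (delta s) f = f s := by
  classical
  have := lp.inner_single_left (𝕜 := ℂ) s (1 : ℂ) f
  simp only [RCLike.inner_apply, map_one, mul_one] at this
  rw [← this, delta]

theorem lam_delta {Γ : Type*} [Group Γ] (g t : Γ) : lam g (delta t) = delta (g * t) := by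
  classical
  ext s
  rw [lam_apply, delta_apply, delta_apply]
  simp [inv_mul_eq_iff_eq_mul]

theorem hasSum_delta {Γ : Type*} (f : L2 Γ) : HasSum (fun t => f t • delta t) f := by
  classical
  have := lp.hasSum_single (p := 2) (by norm_num) f
  convert this using 2 with t
  rw [delta, ← lp.single_smul]
  simp only [smul_eq_mul, mul_one]

/-- Operators on `ℓ²(Γ)` are determined by their matrices. -/
theorem op_ext {Γ : Type*} {S T : L2 Γ →L[ℂ] L2 Γ} (h : ∀ s t, S (delta t) s = T (delta t) s) :
    S = T := by
  ext1 f
  have h1 : ∀ t, S (delta t) = T (delta t) := fun t => by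
    ext s
    exact h s t
  have hS := (hasSum_delta f).mapL S
  have hT := (hasSum_delta f).mapL T
  simp only [map_smul, h1] at hS hT
  exact hS.unique hT

/-- The matrix of a product, summed along an arbitrary enumeration of the middle index. -/
theorem mul_delta_apply {Γ : Type*} (S T : L2 Γ →L[ℂ] L2 Γ) (s t : Γ) (σ : Equiv.Perm Γ) :
    (S * T) (delta t) s = ∑' u, T (delta t) (σ u) * S (delta (σ u)) s := by
  have h := (hasSum_delta (T (delta t))).mapL S
  have h2 := h.mapL (innerSL ℂ (delta s))
  simp only [map_smul, innerSL_apply_apply, inner_delta, smul_eq_mul] at h2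
  rw [σ.tsum_eq (fun u => T (delta t) u * S (delta u) s), h2.tsum_eq]
  rfl

open scoped Classical in
theorem blockDiag_delta {Γ Q : Type*} (c : Γ → Q) (T : L2 Γ →L[ℂ] L2 Γ) (s t : Γ) :
    blockDiag c T (delta t) s = if c s = c t then T (delta t) s else 0 := by
  rw [blockDiag_apply]
  have : cutOff (c ⁻¹' {c s}) (delta t) = if c s = c t then delta t else 0 := by
    ext u
    rw [cutOff_apply]
    by_cases hu : u = t
    · subst hu
      by_cases h : c s = c u
      · simp [h]
      · have h' : c u ≠ c s := fun h' => h h'.symm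
        simp [h, h']
    · by_cases h : c s = c t <;> simp [h, delta_apply, hu]
  rw [this]
  split_ifs
  · rfl
  · rw [map_zero]
    rfl

/-- The right translations: `(ρ(g) f)(t) = f(t g)`. -/
def rho {Γ : Type*} [Group Γ] (g : Γ) : L2 Γ →L[ℂ] L2 Γ := permOp (Equiv.mulRight g⁻¹)

theorem rho_apply {Γ : Type*} [Group Γ] (g : Γ) (f : L2 Γ) (t : Γ) : rho g f t = f (t * g) := by
  simp [rho, permOp_apply]

theorem lam_mul_rho {Γ : Type*} [Group Γ] (g k : Γ) : lam g * rho k = rho k * lam g := by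
  ext f t
  change lam g (rho k f) t = rho k (lam g f) t
  rw [lam_apply, rho_apply, rho_apply, lam_apply, mul_assoc]

theorem star_lam {Γ : Type*} [Group Γ] (g : Γ) : star (lam g) = lam g⁻¹ := by
  refine op_ext fun s t => ?_
  rw [← inner_delta, ContinuousLinearMap.star_eq_adjoint, ContinuousLinearMap.adjoint_inner_right,
    lam_delta, lam_delta, inner_delta]
  classical
  rw [delta_apply, delta_apply]
  simp [eq_inv_mul_iff_mul_eq]

/-- The matrix of an element of `L(Γ)` depends only on `s t⁻¹`. -/
theorem entry_of_mem {Γ : Type*} [Group Γ] {T : L2 Γ →L[ℂ] L2 Γ} (hT : T ∈ groupVN Γ) (s t : Γ) :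
    T (delta t) s = T (delta 1) (s * t⁻¹) := by
  have hρ : rho t⁻¹ ∈ StarSubalgebra.centralizer ℂ (lam '' ((⊤ : Subgroup Γ) : Set Γ)) := by
    rw [StarSubalgebra.mem_centralizer_iff]
    rintro _ ⟨g, -, rfl⟩
    rw [star_lam]
    exact ⟨lam_mul_rho _ _, lam_mul_rho _ _⟩
  have h := ((StarSubalgebra.mem_centralizer_iff ℂ).1 hT _ hρ).1
  have h2 : rho t⁻¹ (delta 1) = delta t := by
    classical
    ext u
    rw [rho_apply, delta_apply, delta_apply]
    simp [mul_inv_eq_one]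
  calc T (delta t) s = (T * rho t⁻¹) (delta 1) s := by rw [← h2]; rfl
    _ = (rho t⁻¹ * T) (delta 1) s := by rw [h]
    _ = T (delta 1) (s * t⁻¹) := rho_apply _ _ _

/-- The map `Γ → K \ Γ`. -/
def coset {Γ : Type*} [Group Γ] (K : Subgroup Γ) (t : Γ) : Quotient (QuotientGroup.rightRel K) :=
  Quotient.mk _ t

theorem coset_eq {Γ : Type*} [Group Γ] (K : Subgroup Γ) (s t : Γ) :
    coset K s = coset K t ↔ s * t⁻¹ ∈ K := by
  rw [eq_comm, coset, coset, Quotient.eq, QuotientGroup.rightRel_apply]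

theorem blockDiag_mem {Γ : Type*} [Group Γ] (K : Subgroup Γ) {T : L2 Γ →L[ℂ] L2 Γ}
    (hT : T ∈ groupVN Γ) : blockDiag (coset K) T ∈ subgroupVN K := by
  classical
  have key : ∀ S ∈ StarSubalgebra.centralizer ℂ (lam '' (K : Set Γ)),
      S * blockDiag (coset K) T = blockDiag (coset K) T * S := by
    intro S hS
    have hinv : ∀ k ∈ K, ∀ s t, S (delta (k * t)) s = S (delta t) (k⁻¹ * s) := by
      intro k hk s t
      have h := ((StarSubalgebra.mem_centralizer_iff ℂ).1 hS (lam k) ⟨k, hk, rfl⟩).1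
      calc S (delta (k * t)) s = (S * lam k) (delta t) s := by rw [← lam_delta]; rfl
        _ = (lam k * S) (delta t) s := by rw [h]
        _ = S (delta t) (k⁻¹ * s) := lam_apply _ _ _
    refine op_ext fun s t => ?_
    rw [mul_delta_apply _ _ _ _ (Equiv.mulRight t),
      mul_delta_apply _ _ _ _ ((Equiv.inv Γ).trans (Equiv.mulRight s))]
    refine tsum_congr fun v => ?_
    simp only [Equiv.coe_mulRight, Equiv.trans_apply, Equiv.inv_apply]
    rw [blockDiag_delta, blockDiag_delta, entry_of_mem hT (v * t) t, entry_of_mem hT s (v⁻¹ * s)]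
    have e1 : coset K (v * t) = coset K t ↔ v ∈ K := by rw [coset_eq]; simp
    have e2 : coset K s = coset K (v⁻¹ * s) ↔ v ∈ K := by rw [coset_eq]; simp
    have e3 : s * (v⁻¹ * s)⁻¹ = v := by simp
    rw [mul_inv_cancel_right, e3]
    by_cases hv : v ∈ K
    · simp only [e1, e2, hv, if_true]
      rw [hinv v hv, mul_comm]
    · simp only [e1, e2, hv, if_false, zero_mul, mul_zero]
  change _ ∈ StarSubalgebra.centralizer ℂ _
  rw [StarSubalgebra.mem_centralizer_iff]
  exact fun S hS => ⟨key S hS, key _ (star_mem hS)⟩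

/-- The trace preserving conditional expectation of `L(Γ)` onto `λ(K)''`, for a subgroup `K`:
it maps `∑ t_g g` to `∑_{g ∈ K} t_g g`. -/
def condExp {Γ : Type*} [Group Γ] (K : Subgroup Γ) : groupVN Γ →ₗ[ℂ] subgroupVN K where
  toFun T := ⟨blockDiag (coset K) T, blockDiag_mem K T.2⟩
  map_add' S T := Subtype.ext (map_add (blockDiag (coset K)) (S : L2 Γ →L[ℂ] L2 Γ) T)
  map_smul' c T := Subtype.ext (map_smul (blockDiag (coset K)) c (T : L2 Γ →L[ℂ] L2 Γ))

theorem subgroupVN_mono {Γ : Type*} [Group Γ] {K K' : Subgroup Γ} (h : K ≤ K') :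
    subgroupVN K ≤ subgroupVN K' :=
  fun _ hT => StarSubalgebra.centralizer_le ℂ _ _
    (StarSubalgebra.centralizer_le ℂ _ _ (Set.image_mono h)) hT

/-- The inclusion of `λ(K)''` into `L(Γ)`. -/
def incl {Γ : Type*} [Group Γ] (K : Subgroup Γ) (T : subgroupVN K) : groupVN Γ :=
  ⟨T, subgroupVN_mono le_top T.2⟩

/-! ### The amalgamated free product -/

/-- The embedding of `F₁ = ⟨h⟩` into `F₂` that maps `h` to the commutator `a b a⁻¹ b⁻¹` of the two
free generators `a`, `b`. -/
def commHom : FreeGroup Unit →* FreeGroup (Fin 2) :=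
  FreeGroup.lift fun _ => FreeGroup.of 0 * FreeGroup.of 1 * (FreeGroup.of 0)⁻¹ * (FreeGroup.of 1)⁻¹

theorem commHom_injective : Function.Injective commHom := by
  rw [injective_iff_map_eq_one]
  intro g hg
  obtain ⟨n, rfl⟩ := FreeGroup.freeGroupUnitEquivInt.symm.surjective g
  have h1 : FreeGroup.freeGroupUnitEquivInt.symm n = FreeGroup.of () ^ n := rfl
  rw [h1] at hg ⊢
  rw [map_zpow] at hg
  have h2 : commHom (FreeGroup.of ()) ≠ 1 := by
    rw [commHom, FreeGroup.lift_apply_of]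
    decide
  rw [(IsMulTorsionFree.zpow_eq_one_iff_right h2).1 hg, zpow_zero]

/-- The amalgamated free product of groups `F₂ *_{F₁} F₂ = ⟨a, b⟩ *_{⟨h⟩} ⟨c, d⟩`, where
`h = a b a⁻¹ b⁻¹ = c d c⁻¹ d⁻¹`. -/
abbrev SurfaceGroup : Type := Monoid.PushoutI (fun _ : Fin 2 => commHom)

/-- The embedding of the first (`i = 0`) or second (`i = 1`) copy of `F₂`. -/
def emb (i : Fin 2) : FreeGroup (Fin 2) →* SurfaceGroup :=
  Monoid.PushoutI.of (φ := fun _ : Fin 2 => commHom) i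

/-- The four generators `a`, `b`, `c`, `d`. -/
def letter : Fin 4 → SurfaceGroup :=
  ![emb 0 (FreeGroup.of 0), emb 0 (FreeGroup.of 1), emb 1 (FreeGroup.of 0), emb 1 (FreeGroup.of 1)]

/-- The subgroup `F₁ = ⟨h⟩` along which the two copies of `F₂` are amalgamated. -/
def amalgSubgroup : Subgroup SurfaceGroup :=
  (Monoid.PushoutI.base (fun _ : Fin 2 => commHom)).range

/-- The W*-algebra `L(F₂) *_{L(F₁)} L(F₂) = L(F₂ *_{F₁} F₂)`. The two copies of `L(F₂)` in it are
`subgroupVN (emb i).range`, and `L(F₁)` is `subgroupVN amalgSubgroup`; see `free_over_amalg`. -/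
abbrev AmalgAlg : Type := groupVN SurfaceGroup

/-- The subalgebra `L(F₁)` of `L(F₂) *_{L(F₁)} L(F₂)`. -/
abbrev BaseAlg : Type := subgroupVN amalgSubgroup

/-- The conditional expectation `E` of `L(F₂) *_{L(F₁)} L(F₂)` onto `L(F₁)`. -/
def amalgExp : AmalgAlg →ₗ[ℂ] BaseAlg := condExp amalgSubgroup

theorem apply_one_eq_zero_of_mem {Γ : Type*} [Group Γ] {K : Subgroup Γ} {T : L2 Γ →L[ℂ] L2 Γ}
    (hT : T ∈ subgroupVN K) {s : Γ} (hs : s ∉ K) : T (delta 1) s = 0 := by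
  classical
  have hT' : T ∈ groupVN Γ := subgroupVN_mono le_top hT
  have hP : blockDiag (coset K) (1 : L2 Γ →L[ℂ] L2 Γ) = 1 := by
    refine op_ext fun s t => ?_
    rw [blockDiag_delta]
    split_ifs with h
    · rfl
    · have : s ≠ t := fun h' => h (by rw [h'])
      change 0 = delta t s
      rw [delta_apply, if_neg this]
  let P : L2 Γ →L[ℂ] L2 Γ := LinearMap.mkContinuous (cutOff (K : Set Γ)) 1 fun f => by
    rw [one_mul]
    refine norm_le_of_sum_le _ (norm_nonneg _) fun F => ?_
    rw [norm_sq_eq]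
    refine le_trans (Finset.sum_le_sum fun t _ => ?_)
      ((summable_sq f).sum_le_tsum F fun t _ => by positivity)
    rw [cutOff_apply]
    split_ifs <;> simp
  have hPa : ∀ f t, P f t = if t ∈ K then f t else 0 := fun f t => cutOff_apply _ f t
  have hc : ∀ k ∈ K, lam k * P = P * lam k := by
    intro k hk
    ext f t
    change lam k (P f) t = P (lam k f) t
    rw [lam_apply, hPa, hPa, lam_apply]
    simp only [K.mul_mem_cancel_left (K.inv_mem hk)]
  have hPm : P ∈ StarSubalgebra.centralizer ℂ (lam '' (K : Set Γ)) := by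
    rw [StarSubalgebra.mem_centralizer_iff]
    rintro _ ⟨k, hk, rfl⟩
    rw [star_lam]
    exact ⟨hc k hk, hc _ (K.inv_mem hk)⟩
  have h := ((StarSubalgebra.mem_centralizer_iff ℂ).1 hT P hPm).1
  have h1 : P (delta 1) = delta 1 := by
    ext t
    rw [hPa, delta_apply]
    by_cases ht : t = 1
    · simp [ht, K.one_mem]
    · simp [ht]
  calc T (delta 1) s = (T * P) (delta 1) s := by rw [← h1]; simp [h1]
    _ = (P * T) (delta 1) s := by rw [h]
    _ = 0 := by
      change P (T (delta 1)) s = 0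
      rw [hPa, if_neg hs]

theorem prod_support (l : List (Fin 2 × AmalgAlg))
    (hl : ∀ p ∈ l, (p.2 : L2 SurfaceGroup →L[ℂ] L2 SurfaceGroup) ∈ subgroupVN (emb p.1).range ∧
      amalgExp p.2 = 0) (s : SurfaceGroup)
    (hs : (((l.map Prod.snd).prod : AmalgAlg) : L2 SurfaceGroup →L[ℂ] L2 SurfaceGroup)
      (delta 1) s ≠ 0) :
    ∃ w : List (Σ _ : Fin 2, FreeGroup (Fin 2)), w.map Sigma.fst = l.map Prod.fst ∧
      (∀ p ∈ w, p.2 ∉ commHom.range) ∧ (w.map fun p => emb p.1 p.2).prod = s := by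
  classical
  induction l generalizing s with
  | nil =>
    refine ⟨[], rfl, by simp, ?_⟩
    by_contra h
    refine hs ?_
    change delta 1 s = 0
    rw [delta_apply, if_neg]
    intro h'
    exact h (by simp [h'])
  | cons p l ih =>
    have hp := hl p (by simp)
    have hs' : ((p.2 : L2 SurfaceGroup →L[ℂ] L2 SurfaceGroup) *
      (((l.map Prod.snd).prod : AmalgAlg) : L2 SurfaceGroup →L[ℂ] L2 SurfaceGroup))
      (delta 1) s ≠ 0 := hs
    rw [mul_delta_apply _ _ _ _ (Equiv.refl _)] at hs'
    obtain ⟨u, hu⟩ : ∃ u, (((l.map Prod.snd).prod : AmalgAlg) :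
        L2 SurfaceGroup →L[ℂ] L2 SurfaceGroup) (delta 1) u *
        (p.2 : L2 SurfaceGroup →L[ℂ] L2 SurfaceGroup) (delta u) s ≠ 0 := by
      by_contra hcon
      push Not at hcon
      exact hs' (by simp only [Equiv.refl_apply, hcon, tsum_zero])
    obtain ⟨w, hw1, hw2, hw3⟩ := ih (fun q hq => hl q (by simp [hq])) u (left_ne_zero_of_mul hu)
    have h2 := right_ne_zero_of_mul hu
    rw [entry_of_mem p.2.2] at h2
    have h3 : s * u⁻¹ ∈ (emb p.1).range := by
      by_contra h
      exact h2 (apply_one_eq_zero_of_mem hp.1 h)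
    have h4 : s * u⁻¹ ∉ amalgSubgroup := by
      intro h
      refine h2 ?_
      have h5 : blockDiag (coset amalgSubgroup) (p.2 : L2 SurfaceGroup →L[ℂ] L2 SurfaceGroup)
        (delta 1) (s * u⁻¹) = 0 := by
        have : blockDiag (coset amalgSubgroup) (p.2 : L2 SurfaceGroup →L[ℂ] L2 SurfaceGroup) = 0 :=
          congrArg Subtype.val hp.2
        rw [this]
        rfl
      rw [blockDiag_delta, if_pos] at h5
      · exact h5
      · rw [coset_eq]
        simpa using h
    obtain ⟨g, hg⟩ := h3
    refine ⟨⟨p.1, g⟩ :: w, by simp [hw1], ?_, by simp [hw3, hg]⟩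
    intro q hq
    rcases List.mem_cons.1 hq with rfl | hq
    · rintro ⟨k, hk⟩
      refine h4 ⟨k, ?_⟩
      rw [← hg]
      change _ = emb p.1 (Sigma.snd (⟨p.1, g⟩ : Σ _ : Fin 2, FreeGroup (Fin 2)))
      rw [← hk]
      exact (Monoid.PushoutI.of_apply_eq_base (fun _ : Fin 2 => commHom) p.1 k).symm
    · exact hw2 q hq

/-- The two copies of `L(F₂)` are free over `L(F₁)` with respect to `E`: an alternating product of
elements `T` with `E(T) = 0` has expectation `0`. -/
theorem free_over_amalg (l : List (Fin 2 × AmalgAlg)) (hne : l ≠ [])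
    (halt : l.IsChain fun p q => p.1 ≠ q.1)
    (hl : ∀ p ∈ l, (p.2 : L2 SurfaceGroup →L[ℂ] L2 SurfaceGroup) ∈ subgroupVN (emb p.1).range ∧
      amalgExp p.2 = 0) : amalgExp (l.map Prod.snd).prod = 0 := by
  classical
  refine Subtype.ext (op_ext fun s t => ?_)
  change blockDiag (coset amalgSubgroup) _ (delta t) s = 0
  rw [blockDiag_delta]
  split_ifs with hst
  swap
  · rfl
  rw [coset_eq] at hst
  rw [entry_of_mem (Subtype.prop _)]
  by_contra hcon
  obtain ⟨w, hw1, hw2, hw3⟩ := prod_support l hl _ hcon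
  have hchain : w.IsChain fun p q => p.1 ≠ q.1 := by
    rw [← List.isChain_map (R := fun i j : Fin 2 => i ≠ j) (f := Sigma.fst), hw1, List.isChain_map]
    exact halt
  let W : Monoid.CoprodI.Word (fun _ : Fin 2 => FreeGroup (Fin 2)) :=
    ⟨w, fun p hp h => hw2 p hp (h ▸ Subgroup.one_mem _), hchain⟩
  have hW : Monoid.PushoutI.Reduced (fun _ : Fin 2 => commHom) W := fun p hp => hw2 p hp
  have hprod : Monoid.PushoutI.ofCoprodI (φ := fun _ : Fin 2 => commHom) W.prod = s * t⁻¹ := by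
    rw [← hw3]
    change Monoid.PushoutI.ofCoprodI 
      (List.prod (w.map fun l => Monoid.CoprodI.of (M := fun _ : Fin 2 => FreeGroup (Fin 2)) l.snd)) = _
    rw [map_list_prod, List.map_map]
    rfl
  have := hW.eq_empty_of_mem_range (fun _ => commHom_injective) (by rw [hprod]; exact hst)
  have hw : w = [] := congrArg Monoid.CoprodI.Word.toList this
  rw [hw] at hw1
  exact hne (by simpa using hw1.symm)

/-! ### Noncrossing partitions and operator-valued moments -/

/-- A partition of `{1, …, n}` is noncrossing if there are no `i < j < k < l` with `i, k` in one
block and `j, l` in another block. -/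
def IsNoncrossing {n : ℕ} (P : Finpartition (Finset.univ : Finset (Fin n))) : Prop :=
  ∀ V ∈ P.parts, ∀ W ∈ P.parts, ∀ i ∈ V, ∀ j ∈ W, ∀ k ∈ V, ∀ l ∈ W, i < j → j < k → k < l → V = W

/-- The set `NC(n)` of noncrossing partitions, ordered by refinement. -/
abbrev NC (n : ℕ) : Type :=
  {P : Finpartition (Finset.univ : Finset (Fin n)) // IsNoncrossing P}

open scoped Classical in
instance instFintypeNC (n : ℕ) : Fintype (NC n) := Fintype.ofFinite _

open scoped Classical in
instance instLocallyFiniteOrderNC (n : ℕ) : LocallyFiniteOrder (NC n) :=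
  Fintype.toLocallyFiniteOrder

/-- All blocks have even size. -/
def IsEven {n : ℕ} (π : NC n) : Prop := ∀ V ∈ π.1.parts, Even V.card

open scoped Classical in
/-- The Möbius function of the lattice `NC(n)`. -/
def moebius {n : ℕ} (π θ : NC n) : ℂ := IncidenceAlgebra.mu ℂ π θ

open scoped Classical in
/-- One step of the evaluation of a nested moment from left to right. The list holds the unfinished
products of the blocks that are open at position `k`, the innermost one first, and as its last entry
the product of the expectations of the finished outer blocks. If `k` is the first element of its
block, a new product is opened with the factor `a k`; otherwise `a k` is multiplied to the innermost
open product. If `k` is the last element of its block, the expectation of the product of this block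
is multiplied to the product around it. -/
def nestStep {A : Type*} [Ring A] (E : A → A) {n : ℕ} (a : Fin n → A) (π : NC n) (S : List A)
    (k : Fin n) : List A :=
  let S' := if ∀ j ∈ π.1.part k, k ≤ j then a k :: S else
    match S with
    | t :: r => (t * a k) :: r
    | [] => []
  if ∀ j ∈ π.1.part k, j ≤ k then
    match S' with
    | t :: u :: r => (u * E t) :: r
    | r => r
  else S'

/-- The partition dependent moment `Ê(π)(a₁ ⊗ ⋯ ⊗ aₙ)`: each block contributes `E` of the product of
its elements, with the contributions of the blocks nested in it inserted in their places. For
example, `π = {{1, 4}, {2, 3}, {5, 6}}` gives `E(a₁ E(a₂ a₃) a₄) E(a₅ a₆)`. -/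
def nestedMoment {A : Type*} [Ring A] (E : A → A) {n : ℕ} (a : Fin n → A) (π : NC n) : A :=
  ((List.finRange n).foldl (nestStep E a π) [1]).headD 1

/-! ### The elements and words of the statement -/

/-- `x = a + b + a⁻¹ + b⁻¹`. -/
def xElt : AmalgAlg := unit (letter 0) + unit (letter 1) + unit (letter 0)⁻¹ + unit (letter 1)⁻¹

/-- `y = c + d + c⁻¹ + d⁻¹`. -/
def yElt : AmalgAlg := unit (letter 2) + unit (letter 3) + unit (letter 2)⁻¹ + unit (letter 3)⁻¹

/-- `Ψ_x(π) = Ê(π)(x ⊗ ⋯ ⊗ x)`, an element of `L(F₁)`. -/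
def psi {n : ℕ} (π : NC n) : AmalgAlg :=
  nestedMoment (fun T => incl amalgSubgroup (amalgExp T)) (fun _ => xElt) π

/-- The sum of the free generators of `F₄` and of their inverses, in `L(F₄)`. -/
def freeSum : groupVN (FreeGroup (Fin 4)) :=
  ∑ i : Fin 4, (unit (FreeGroup.of i) + unit (FreeGroup.of i)⁻¹)

/-- The surface relator `a b a⁻¹ b⁻¹ d c d⁻¹ c⁻¹`, as a word in the letters `a, b, c, d` (numbered
`0, 1, 2, 3`) with exponents `1` (`true`) and `-1` (`false`). -/
def relator : List (Fin 4 × Bool) :=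
  [(0, true), (1, true), (0, false), (1, false), (3, true), (2, true), (3, false), (2, false)]

/-- The words of length `n` in `a, b, c, d` and their inverses that represent the identity of
`F₂ *_{F₁} F₂` but not the identity of the free group on `a, b, c, d`. -/
def surfaceWords (n : ℕ) : Set (List (Fin 4 × Bool)) :=
  {w | w.length = n ∧ FreeGroup.lift letter (FreeGroup.mk w) = 1 ∧ FreeGroup.mk w ≠ 1}

end FreeAmalgam

end

noncomputable section

namespace FreeAmalgam

/-! ### Words and moments -/

/-! The trace of a power of a sum of group elements counts the words that spell the identity. For `x
+ y` this number is squeezed between two equal bounds. From below, the words trivial in the free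
group number 44248 by a recursion on reduced length (`countP_words_free`), and the 16 rotations of
the relator and of its inverse are further words trivial in the amalgam. From above, the amalgam
acts on `ℤ × ℤ` through `SL₂(ℤ)`, every trivial word fixes the vector `(17, 5)`, and a finite
computation finds at most 44264 words that do (`countP_surface_le`). Since 44248 + 16 = 44264, the
value of the moment and the list of exceptional words follow together (`surfaceWords_eight`).

For the cumulant formula, the powers of the commutator `h` are cyclically reduced, so E(x²) = 4 and
E(x⁴) = 28 + h + h⁻¹. Together with the trace property, the module property of E and the scalar
moments of x, this determines the trace of every nested moment over an even noncrossing partition of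
eight points; a symbolic evaluator, proved sound in `trace_psi_of_symMoment`, carries this out. The
Möbius sums are not expanded. An explicit function on partitions is shown to satisfy the
moment-cumulant relation (`sum_cumulant`), and Möbius inversion identifies it with the inner sums.
The even partitions form an upper set, so the Möbius function of the whole lattice serves there. It
differs from the free cumulants only by +2 on the four partitions into two blocks of size 4, where
τ(E(x⁴)²) = 28² + 2, and by −8 on the one-block partition. With the weights 2^|θ| this contributes
4·4·2 − 2·8 = 16, the same 16 as in the word count. -/

/-- The words of length `n` in the letters listed in `ls`. -/
def words {A : Type*} (ls : List A) : ℕ → List (List A)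
  | 0 => [[]]
  | n + 1 => ls.flatMap fun a => (words ls n).map (List.cons a)

theorem mem_words {A : Type*} {ls : List A} (hls : ∀ a, a ∈ ls) (n : ℕ) (w : List A) :
    w ∈ words ls n ↔ w.length = n := by
  induction n generalizing w with
  | zero => simp [words]
  | succ n ih =>
    cases w with
    | nil => simp [words]
    | cons a w => simp [words, hls, ih]

theorem nodup_words {A : Type*} {ls : List A} (hls : ls.Nodup) (n : ℕ) : (words ls n).Nodup := by
  induction n with
  | zero => simp [words]
  | succ n ih =>
    rw [words, List.nodup_flatMap]
    refine ⟨fun a _ => ih.map List.cons_injective, hls.imp fun {a b} hab => ?_⟩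
    intro w h1 h2
    simp only [List.mem_map] at h1 h2
    obtain ⟨u, -, rfl⟩ := h1
    obtain ⟨v, -, h⟩ := h2
    exact hab (List.cons.inj h).1.symm

theorem countP_words_succ {A : Type*} (ls : List A) (n : ℕ) (p : List A → Bool) :
    (words ls (n + 1)).countP p =
      (ls.map fun a => (words ls n).countP fun w => p (a :: w)).sum := by
  simp [words, List.countP_flatMap, List.countP_map, Function.comp_def]

theorem sum_flatMap {A R : Type*} [AddMonoid R] (l : List A) (f : A → List R) :
    (l.flatMap f).sum = (l.map fun a => (f a).sum).sum := by
  induction l with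
  | nil => rfl
  | cons a l ih => simp [ih]

theorem countP_words_add {A : Type*} (ls : List A) (m n : ℕ) (p : List A → Bool) :
    (words ls (m + n)).countP p =
      ((words ls m).map fun u => (words ls n).countP fun w => p (u ++ w)).sum := by
  induction m generalizing p with
  | zero => simp [words]
  | succ m ih =>
    rw [Nat.add_right_comm, countP_words_succ]
    simp only [ih, words, List.map_flatMap, List.map_map, sum_flatMap, Function.comp_def,
      List.cons_append]

theorem unit_mul {Γ : Type*} [Group Γ] (g k : Γ) : unit (g * k) = unit g * unit k := by
  refine Subtype.ext (ContinuousLinearMap.ext fun f => ?_)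
  ext t
  change lam (g * k) f t = lam g (lam k f) t
  simp [lam_apply, mul_assoc]

theorem unit_one {Γ : Type*} [Group Γ] : unit (1 : Γ) = 1 := by
  refine Subtype.ext (ContinuousLinearMap.ext fun f => ?_)
  ext t
  change lam 1 f t = f t
  simp [lam_apply]

theorem sum_unit_pow {Γ A : Type*} [Group Γ] (ls : List A) (f : A → Γ) (n : ℕ) :
    (ls.map fun a => unit (f a)).sum ^ n =
      ((words ls n).map fun w => unit (w.map f).prod).sum := by
  induction n with
  | zero => simp [words, unit_one]
  | succ n ih =>
    simp only [pow_succ', ih, words, List.map_flatMap, sum_flatMap, List.map_map,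
      Function.comp_def, List.map_cons, List.prod_cons, unit_mul, List.sum_map_mul_left]
    rw [List.sum_map_mul_right]

/-- The trace as a linear map. -/
def traceLin (Γ : Type*) [Group Γ] : groupVN Γ →ₗ[ℂ] ℂ where
  toFun := trace
  map_add' S T := by
    change inner ℂ _ ((S : L2 Γ →L[ℂ] L2 Γ) (delta 1) + (T : L2 Γ →L[ℂ] L2 Γ) (delta 1)) = _
    rw [inner_add_right]
    rfl
  map_smul' c T := by
    change inner ℂ _ (c • (T : L2 Γ →L[ℂ] L2 Γ) (delta 1)) = _
    rw [inner_smul_right]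
    rfl

theorem traceLin_apply {Γ : Type*} [Group Γ] (T : groupVN Γ) : traceLin Γ T = trace T := rfl

theorem trace_eq_apply {Γ : Type*} [Group Γ] (T : groupVN Γ) :
    trace T = (T : L2 Γ →L[ℂ] L2 Γ) (delta 1) 1 := inner_delta _ _

open scoped Classical in
theorem trace_unit {Γ : Type*} [Group Γ] (g : Γ) : trace (unit g) = if g = 1 then 1 else 0 := by
  rw [trace_eq_apply]
  change lam g (delta 1) 1 = _
  rw [lam_delta, delta_apply]
  simp [eq_comm]

theorem sum_map_ite_eq_countP {A R : Type*} [Semiring R] (l : List A) (p : A → Prop)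
    [DecidablePred p] :
    (l.map fun a => if p a then (1 : R) else 0).sum = (l.countP fun a => decide (p a) : ℕ) := by
  induction l with
  | nil => simp
  | cons a l ih => by_cases h : p a <;> simp [h, ih, add_comm]

open scoped Classical in
-- The power expands into one group element per word, and the trace keeps only those equal to the
-- identity. This turns moments into word counts.
theorem trace_sum_unit_pow {Γ A : Type*} [Group Γ] (ls : List A) (f : A → Γ) (n : ℕ) :
    trace ((ls.map fun a => unit (f a)).sum ^ n) =
      ((words ls n).countP fun w => decide ((w.map f).prod = 1) : ℕ) := by
  rw [sum_unit_pow, ← traceLin_apply, map_list_sum, List.map_map, ← sum_map_ite_eq_countP]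
  simp only [Function.comp_def, traceLin_apply, trace_unit]

/-! ### Words in a free group -/

/-- The letters `a_i`, `a_i⁻¹` of the free group on `d` generators. -/
def letters (d : ℕ) : List (Fin d × Bool) := List.finRange d ×ˢ [true, false]

theorem mem_letters {d : ℕ} (a : Fin d × Bool) : a ∈ letters d := by
  obtain ⟨i, b⟩ := a
  cases b <;> simp [letters]

theorem nodup_letters (d : ℕ) : (letters d).Nodup :=
  (List.nodup_finRange d).product (by decide)

theorem length_letters (d : ℕ) : (letters d).length = d * 2 := by
  simp [letters, List.length_product]

/-- The number of words of length `n` in the free group on `d` generators that represent a given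
element of length `l`. -/
def freeCount (d : ℕ) : ℕ → ℕ → ℕ
  | 0, 0 => 1
  | 0, _ + 1 => 0
  | n + 1, 0 => d * 2 * freeCount d n 1
  | n + 1, l + 1 => freeCount d n l + (d * 2 - 1) * freeCount d n (l + 2)

/-- The inverse letter either cancels the first letter of the reduced word or lengthens it by one;
no further cancellation can follow. -/
theorem norm_mk_singleton_inv_mul {α : Type*} [DecidableEq α] (a : α × Bool) (g : FreeGroup α) :
    ((FreeGroup.mk [a])⁻¹ * g).norm =
      if g.toWord.head? = some a then g.norm - 1 else g.norm + 1 := by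
  have h1 : (FreeGroup.mk [a])⁻¹ = FreeGroup.mk [(a.1, !a.2)] := by
    simp [FreeGroup.inv_mk, FreeGroup.invRev]
  have h2 : ((FreeGroup.mk [a])⁻¹ * g).toWord = FreeGroup.reduce ((a.1, !a.2) :: g.toWord) := by
    rw [h1, ← FreeGroup.toWord_mk]
    conv_lhs => rw [← FreeGroup.mk_toWord (x := g), FreeGroup.mul_mk]
    rfl
  rw [FreeGroup.norm, h2, FreeGroup.reduce.cons, FreeGroup.reduce_toWord, FreeGroup.norm]
  obtain ⟨i, b⟩ := a
  rcases g.toWord with _ | ⟨⟨j, c⟩, w⟩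
  · simp
  · simp only [List.head?_cons, Option.some.injEq, Prod.mk.injEq]
    by_cases h : j = i ∧ c = b
    · obtain ⟨rfl, rfl⟩ := h
      simp
    · have h' : ¬ (i = j ∧ (!b) = !c) := fun hh => h ⟨hh.1.symm, (Bool.not_inj hh.2).symm⟩
      rw [if_neg h', if_neg h]
      rfl

theorem sum_map_ite_eq {A : Type*} [DecidableEq A] {l : List A} (hl : l.Nodup) {a : A}
    (ha : a ∈ l) (x y : ℕ) :
    (l.map fun b => if a = b then x else y).sum = x + (l.length - 1) * y := by
  obtain ⟨s, t, rfl⟩ := List.append_of_mem ha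
  have hs : ∀ b ∈ s, a ≠ b := by
    rintro b hb rfl
    exact (List.nodup_append.1 hl).2.2 a hb a (by simp) rfl
  have ht : ∀ b ∈ t, a ≠ b := by
    rintro b hb rfl
    exact (List.nodup_cons.1 (List.nodup_append.1 hl).2.1).1 hb
  rw [List.map_append, List.map_cons,
    List.map_congr_left (g := fun _ => y) fun b hb => if_neg (hs b hb),
    List.map_congr_left (l := t) (g := fun _ => y) fun b hb => if_neg (ht b hb)]
  simp
  ring

/-- Splitting off the first letter a replaces g by a⁻¹g. If g ≠ 1, exactly one of the 2d letters
shortens g; if g = 1, all of them lengthen it. Hence the count depends on g only through its length.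
-/
theorem countP_words_free {d : ℕ} (n : ℕ) (g : FreeGroup (Fin d)) :
    (words (letters d) n).countP (fun w => decide (FreeGroup.mk w = g)) =
      freeCount d n g.norm := by
  induction n generalizing g with
  | zero =>
    by_cases h : g = 1
    · subst h; simp [words, freeCount, ← FreeGroup.one_eq_mk]
    · obtain ⟨l, hl⟩ := Nat.exists_eq_succ_of_ne_zero (mt FreeGroup.norm_eq_zero.1 h)
      have h' : FreeGroup.mk [] ≠ g := fun hh => h (by rw [← hh]; rfl)
      simp [words, hl, freeCount, h']
  | succ n ih =>
    have h1 : ∀ (a : Fin d × Bool) (w : List (Fin d × Bool)),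
        FreeGroup.mk (a :: w) = g ↔ FreeGroup.mk w = (FreeGroup.mk [a])⁻¹ * g := by
      intro a w
      rw [eq_inv_mul_iff_mul_eq, FreeGroup.mul_mk, List.singleton_append]
    rw [countP_words_succ]
    simp only [h1, ih, norm_mk_singleton_inv_mul]
    rcases hg : g.toWord with _ | ⟨a, w⟩
    · have : g.norm = 0 := by rw [FreeGroup.norm, hg]; rfl
      simp [this, freeCount, length_letters]
    · have : g.norm = w.length + 1 := by rw [FreeGroup.norm, hg]; rfl
      simp only [this, freeCount, List.head?_cons, Option.some.injEq]
      rw [← length_letters d, ← sum_map_ite_eq (nodup_letters d) (mem_letters a)]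
      congr 1
      refine List.map_congr_left fun b _ => ?_
      split_ifs <;> rfl

/-! ### A linear action of the surface group -/

/-- The action of an integer `2 × 2` matrix on `ℤ × ℤ`. -/
def matAct (p q r s : ℤ) (v : ℤ × ℤ) : ℤ × ℤ := (p * v.1 + q * v.2, r * v.1 + s * v.2)

theorem matAct_matAct {p q r s p' q' r' s' : ℤ} (v : ℤ × ℤ) :
    matAct p q r s (matAct p' q' r' s' v) =
      matAct (p * p' + q * r') (p * q' + q * s') (r * p' + s * r') (r * q' + s * s') v := by
  simp only [matAct, Prod.mk.injEq]
  constructor <;> ring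

theorem matAct_one (v : ℤ × ℤ) : matAct 1 0 0 1 v = v := by
  simp [matAct]

/-- The permutation of `ℤ × ℤ` given by a matrix of determinant `1`. -/
def matPerm (p q r s : ℤ) (h : p * s - q * r = 1) : Equiv.Perm (ℤ × ℤ) where
  toFun := matAct p q r s
  invFun := matAct s (-q) (-r) p
  left_inv v := by
    rw [matAct_matAct]
    convert matAct_one v using 2 <;> linarith
  right_inv v := by
    rw [matAct_matAct]
    convert matAct_one v using 2 <;> linarith

/-- The images of the generators under a representation of the surface group in `SL₂(ℤ)`: two
pairs of matrices with the same commutator. -/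
def genPerm : Fin 4 → Equiv.Perm (ℤ × ℤ) :=
  ![matPerm 1 1 1 2 (by norm_num), matPerm 1 (-1) (-1) 2 (by norm_num),
    matPerm (-6) 1 (-55) 9 (by norm_num), matPerm 8 (-1) 41 (-5) (by norm_num)]

/-- Both commutators are the matrix with rows (−1, 0), (−6, −1). The second pair is the first
conjugated by the matrix with rows (1, 0), (7, 1), which commutes with it. -/
theorem genPerm_commutator :
    genPerm 0 * genPerm 1 * (genPerm 0)⁻¹ * (genPerm 1)⁻¹ =
      genPerm 2 * genPerm 3 * (genPerm 2)⁻¹ * (genPerm 3)⁻¹ := by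
  refine Equiv.ext fun v => ?_
  change matAct _ _ _ _ (matAct _ _ _ _ (matAct _ _ _ _ (matAct _ _ _ _ v))) =
    matAct _ _ _ _ (matAct _ _ _ _ (matAct _ _ _ _ (matAct _ _ _ _ v)))
  simp only [matAct_matAct]
  norm_num

/-- The representation of the surface group by permutations of `ℤ × ℤ` that extends `genPerm`. -/
def surfaceRep : SurfaceGroup →* Equiv.Perm (ℤ × ℤ) :=
  Monoid.PushoutI.lift
    (fun i => FreeGroup.lift (![![genPerm 0, genPerm 1], ![genPerm 2, genPerm 3]] i))
    (FreeGroup.lift fun _ => genPerm 0 * genPerm 1 * (genPerm 0)⁻¹ * (genPerm 1)⁻¹) fun i => by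
      refine FreeGroup.ext_hom _ _ fun u => ?_
      fin_cases i
      · simp [commHom]
      · simp [commHom, genPerm_commutator]

theorem surfaceRep_letter (i : Fin 4) : surfaceRep (letter i) = genPerm i := by
  fin_cases i <;> simp [surfaceRep, letter, emb]

/-- The element of the surface group given by a letter. -/
def letterElt (a : Fin 4 × Bool) : SurfaceGroup :=
  bif a.2 then letter a.1 else (letter a.1)⁻¹

theorem lift_letter_mk (w : List (Fin 4 × Bool)) :
    FreeGroup.lift letter (FreeGroup.mk w) = (w.map letterElt).prod :=
  FreeGroup.lift_mk

/-- The action of the letters on `ℤ × ℤ`. -/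
def letterAct : Fin 4 × Bool → ℤ × ℤ → ℤ × ℤ
  | (0, true) => matAct 1 1 1 2
  | (0, false) => matAct 2 (-1) (-1) 1
  | (1, true) => matAct 1 (-1) (-1) 2
  | (1, false) => matAct 2 1 1 1
  | (2, true) => matAct (-6) 1 (-55) 9
  | (2, false) => matAct 9 (-1) 55 (-6)
  | (3, true) => matAct 8 (-1) 41 (-5)
  | (3, false) => matAct (-5) 1 (-41) 8

theorem surfaceRep_letterElt (a : Fin 4 × Bool) (v : ℤ × ℤ) :
    surfaceRep (letterElt a) v = letterAct a v := by
  obtain ⟨i, b⟩ := a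
  cases b
  · simp only [letterElt, cond_false, map_inv, surfaceRep_letter]
    fin_cases i <;> rfl
  · simp only [letterElt, cond_true, surfaceRep_letter]
    fin_cases i <;> rfl

theorem surfaceRep_letterElt_inv (a : Fin 4 × Bool) (v : ℤ × ℤ) :
    (surfaceRep (letterElt a))⁻¹ v = letterAct (a.1, !a.2) v := by
  rw [← surfaceRep_letterElt, ← map_inv]
  obtain ⟨i, b⟩ := a
  cases b <;> simp [letterElt]

/-- The images of `v` under the words of length `n`. -/
def images (ls : List (Fin 4 × Bool)) (v : ℤ × ℤ) : ℕ → List (ℤ × ℤ)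
  | 0 => [v]
  | n + 1 => ls.flatMap fun a => (images ls v n).map (letterAct a)

/-- The images of `v` under the inverses of the words of length `n`. -/
def preimages (ls : List (Fin 4 × Bool)) : ℕ → ℤ × ℤ → List (ℤ × ℤ)
  | 0, v => [v]
  | n + 1, v => ls.flatMap fun a => preimages ls n (letterAct (a.1, !a.2) v)

theorem images_eq (ls : List (Fin 4 × Bool)) (v : ℤ × ℤ) (n : ℕ) :
    images ls v n = (words ls n).map fun w => surfaceRep (w.map letterElt).prod v := by
  induction n with
  | zero => simp [images, words]
  | succ n ih =>
    simp [images, words, ih, List.map_flatMap, Function.comp_def, surfaceRep_letterElt]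

theorem preimages_eq (ls : List (Fin 4 × Bool)) (v : ℤ × ℤ) (n : ℕ) :
    preimages ls n v = (words ls n).map fun w => (surfaceRep (w.map letterElt).prod)⁻¹ v := by
  induction n generalizing v with
  | zero => simp only [preimages, words, List.map_cons, List.map_nil, List.prod_nil, map_one, inv_one,
      Equiv.Perm.one_apply]
  | succ n ih =>
    simp only [preimages, words, ih, List.map_flatMap, List.map_map, Function.comp_def,
      ← surfaceRep_letterElt_inv, List.map_cons, List.prod_cons, map_mul, mul_inv_rev,
      Equiv.Perm.mul_apply]

/-! ### Counting coincidences by sorting into buckets -/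

/-- The number of coincidences of an entry of `l` with an entry of `m`. The entries are sorted
according to their lowest `k` binary digits before they are compared. -/
def matchCount : ℕ → List ℕ → List ℕ → ℕ
  | 0, l, m => (l.map fun x => m.countP fun y => Nat.beq y x).sum
  | _ + 1, [], _ => 0
  | k + 1, x :: l, m =>
    matchCount k ((x :: l).filter fun x => Nat.beq (Nat.mod (Nat.div x (Nat.pow 2 k)) 2) 0)
        (m.filter fun x => Nat.beq (Nat.mod (Nat.div x (Nat.pow 2 k)) 2) 0) +
      matchCount k ((x :: l).filter fun x => Nat.beq (Nat.mod (Nat.div x (Nat.pow 2 k)) 2) 1)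
        (m.filter fun x => Nat.beq (Nat.mod (Nat.div x (Nat.pow 2 k)) 2) 1)

/-- Equal numbers have equal values of f, so sorting by f loses no coincidence. With f a binary
digit, this is one round of bucketing. -/
theorem sum_map_countP_split (f : ℕ → ℕ) (hf : ∀ x, f x = 0 ∨ f x = 1) (l m : List ℕ) :
    (l.map fun x => m.countP fun y => Nat.beq y x).sum =
      ((l.filter fun x => Nat.beq (f x) 0).map fun x =>
        (m.filter fun x => Nat.beq (f x) 0).countP fun y => Nat.beq y x).sum +
      ((l.filter fun x => Nat.beq (f x) 1).map fun x =>
        (m.filter fun x => Nat.beq (f x) 1).countP fun y => Nat.beq y x).sum := by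
  have key : ∀ (i : ℕ) (x : ℕ), f x = i →
      ((m.filter fun x => Nat.beq (f x) i).countP fun y => Nat.beq y x) =
        m.countP fun y => Nat.beq y x := by
    intro i x hx
    rw [List.countP_filter]
    refine List.countP_congr fun y _ => ?_
    simp only [Bool.and_eq_true, Nat.beq_eq]
    exact ⟨fun h => h.1, fun h => ⟨h, by rw [h, hx]⟩⟩
  induction l with
  | nil => rfl
  | cons x l ih =>
    rw [List.map_cons, List.sum_cons, ih, List.filter_cons, List.filter_cons]
    rcases hf x with h | h
    · rw [if_pos (by simp [h]), if_neg (by simp [h]), List.map_cons, List.sum_cons, key 0 x h,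
        add_assoc]
    · rw [if_neg (by simp [h]), if_pos (by simp [h]), List.map_cons, List.sum_cons, key 1 x h]
      ring

theorem matchCount_eq (k : ℕ) (l m : List ℕ) :
    matchCount k l m = (l.map fun x => m.countP fun y => Nat.beq y x).sum := by
  induction k generalizing l m with
  | zero => rw [matchCount]
  | succ k ih =>
    cases l with
    | nil => rfl
    | cons x l =>
      rw [matchCount, ih, ih, ← sum_map_countP_split fun x => Nat.mod (Nat.div x (Nat.pow 2 k)) 2]
      exact fun x => Nat.mod_two_eq_zero_or_one _

/-- A numerical key of an element of `ℤ × ℤ`. -/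
def vecKey (v : ℤ × ℤ) : ℕ := (v.1 + 1000003 * v.2).natAbs % 1000000007

/-- An upper bound for the number of words of length `m + n` that fix `v`. -/
def fixCount (ls : List (Fin 4 × Bool)) (v : ℤ × ℤ) (m n : ℕ) : ℕ :=
  matchCount 13 ((preimages ls m v).map vecKey) ((images ls v n).map vecKey)

open scoped Classical in
-- If uw = 1 then w and u⁻¹ move v to the same point, so it suffices to compare the images under
-- half-length words. Passing from group elements to images of v, and from these to hash keys, can
-- only create coincidences, which is harmless for an upper bound.
theorem countP_le_fixCount (ls : List (Fin 4 × Bool)) (v : ℤ × ℤ) (m n : ℕ) :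
    ((words ls (m + n)).countP fun w => decide ((w.map letterElt).prod = 1)) ≤
      fixCount ls v m n := by
  rw [countP_words_add, fixCount, matchCount_eq, preimages_eq, images_eq, List.map_map,
    List.map_map]
  refine List.sum_le_sum fun u _ => ?_
  simp only [Function.comp_apply, List.map_map, List.countP_map]
  refine List.countP_mono_left fun w _ h => ?_
  simp only [List.map_append, List.prod_append, decide_eq_true_eq, Function.comp_apply,
    Nat.beq_eq] at h ⊢
  rw [eq_inv_of_mul_eq_one_right h, map_inv]

theorem letters_four : letters 4 = [(0, true), (0, false), (1, true), (1, false), (2, true),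
    (2, false), (3, true), (3, false)] := by decide

/-- Neither faithfulness of the action nor injectivity of the keys is needed: the value already
meets the lower bound 44248 + 16, so for this vector no spurious coincidence occurs. The split 4 + 4
compares two lists of 8⁴ entries and avoids running through 8⁸ words. -/
theorem fixCount_eq : fixCount [(0, true), (0, false), (1, true), (1, false), (2, true),
    (2, false), (3, true), (3, false)] (17, 5) 4 4 = 44264 := by
  decide +kernel

/-! ### The words of length eight -/

open scoped Classical in
theorem countP_surface_le :
    ((words (letters 4) 8).countP fun w => decide ((w.map letterElt).prod = 1)) ≤ 44264 := by
  rw [← fixCount_eq, letters_four]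
  exact countP_le_fixCount _ _ 4 4

theorem countP_free_eight :
    ((words (letters 4) 8).countP fun w => decide (FreeGroup.mk w = 1)) = 44248 := by
  rw [countP_words_free, FreeGroup.norm_one]
  decide +kernel

open scoped Classical in
-- Words trivial in the free group are trivial in the amalgam, so the trivial words split into these
-- and the exceptional ones.
theorem countP_surface_eq :
    ((words (letters 4) 8).countP fun w => decide ((w.map letterElt).prod = 1)) =
      44248 + (surfaceWords 8).ncard := by
  have h1 : surfaceWords 8 = ((words (letters 4) 8).filter fun w =>
      decide ((w.map letterElt).prod = 1 ∧ FreeGroup.mk w ≠ 1)).toFinset := by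
    ext w
    simp only [surfaceWords, lift_letter_mk, Set.mem_ofPred_eq, List.coe_toFinset, List.mem_filter,
      mem_words mem_letters, decide_eq_true_eq]
  rw [h1, Set.ncard_coe_finset, List.toFinset_card_of_nodup
    ((nodup_words (nodup_letters 4) 8).filter _), ← List.countP_eq_length_filter,
    ← countP_free_eight]
  generalize words (letters 4) 8 = l
  induction l with
  | nil => rfl
  | cons w l ih =>
    rw [List.countP_cons, List.countP_cons, List.countP_cons, ih]
    have h2 : FreeGroup.mk w = 1 → (w.map letterElt).prod = 1 := fun h => by
      rw [← lift_letter_mk, h, map_one]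
    by_cases h3 : FreeGroup.mk w = 1
    · simp [h3, h2 h3]; omega
    · by_cases h4 : (w.map letterElt).prod = 1 <;> simp [h3, h4]; omega

/-- Rotating a word conjugates the element it represents. -/
theorem map_mk_eq_one_of_isRotated {α M : Type*} [Group M] (f : FreeGroup α →* M)
    {u v : List (α × Bool)} (h : u ~r v) (hu : f (FreeGroup.mk u) = 1) :
    f (FreeGroup.mk v) = 1 := by
  obtain ⟨n, rfl⟩ := h
  rw [List.rotate_eq_drop_append_take_mod, ← FreeGroup.mul_mk, map_mul, mul_eq_one_iff_eq_inv,
    ← mul_eq_one_iff_eq_inv', ← map_mul, FreeGroup.mul_mk, List.take_append_drop, hu]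

theorem isRotated_relator_mem {w : List (Fin 4 × Bool)} (h : w ~r relator) :
    w ∈ surfaceWords 8 := by
  refine ⟨h.perm.length_eq, map_mk_eq_one_of_isRotated _ h.symm ?_, fun hw => ?_⟩
  -- The relator is the quotient of the two commutators, and both are the image of the generator of
  -- the amalgamated subgroup.
  · have hr : emb 0 (commHom (FreeGroup.of ())) = emb 1 (commHom (FreeGroup.of ())) := by
      rw [emb, emb, Monoid.PushoutI.of_apply_eq_base (fun _ : Fin 2 => commHom),
        Monoid.PushoutI.of_apply_eq_base (fun _ : Fin 2 => commHom)]
    rw [← mul_inv_eq_one] at hr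
    rw [lift_letter_mk, ← hr]
    simp [relator, letterElt, letter, commHom, mul_assoc]
  · exact absurd (map_mk_eq_one_of_isRotated (MonoidHom.id _) h hw) (by decide)

theorem invRev_mem_surfaceWords {w : List (Fin 4 × Bool)} {n : ℕ} (h : w ∈ surfaceWords n) :
    FreeGroup.invRev w ∈ surfaceWords n := by
  obtain ⟨h1, h2, h3⟩ := h
  refine ⟨by simp [h1], ?_, ?_⟩
  · rw [← FreeGroup.inv_mk, map_inv, h2, inv_one]
  · rw [← FreeGroup.inv_mk]
    exact inv_ne_one.2 h3

theorem ncard_isRotated_relator :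
    {w | List.IsRotated w relator ∨ List.IsRotated w (FreeGroup.invRev relator)}.ncard = 16 := by
  have : {w | List.IsRotated w relator ∨ List.IsRotated w (FreeGroup.invRev relator)} =
      (relator.cyclicPermutations ++ (FreeGroup.invRev relator).cyclicPermutations).toFinset := by
    ext w
    simp [List.mem_cyclicPermutations_iff]
  rw [this, Set.ncard_coe_finset]
  decide +kernel

/-- The rotations supply 16 exceptional words, and the upper bound 44264 leaves room for no more. -/
theorem surfaceWords_eight : surfaceWords 8 =
    {w | List.IsRotated w relator ∨ List.IsRotated w (FreeGroup.invRev relator)} := by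
  have hfin : (surfaceWords 8).Finite :=
    (List.finite_length_eq _ 8).subset fun w hw => hw.1
  refine (Set.eq_of_subset_of_ncard_le ?_ ?_ hfin).symm
  · rintro w (h | h)
    · exact isRotated_relator_mem h
    · have h' := invRev_mem_surfaceWords (isRotated_relator_mem (List.IsRotated.refl relator))
      refine ⟨h.perm.length_eq.trans h'.1, map_mk_eq_one_of_isRotated _ h.symm h'.2.1,
        fun hw => h'.2.2 (map_mk_eq_one_of_isRotated (MonoidHom.id _) h hw)⟩
  · rw [ncard_isRotated_relator]
    have h1 := countP_surface_le
    rw [countP_surface_eq] at h1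
    omega

theorem ncard_surfaceWords_eight : (surfaceWords 8).ncard = 16 := by
  rw [surfaceWords_eight, ncard_isRotated_relator]

/-! ### The eighth moments of `x + y` and of the free sum -/

theorem xElt_add_yElt : xElt + yElt = ((letters 4).map fun a => unit (letterElt a)).sum := by
  rw [letters_four]
  simp only [xElt, yElt, letterElt, List.map_cons, List.map_nil, List.sum_cons, List.sum_nil,
    cond_true, cond_false]
  abel

theorem trace_surface : trace ((xElt + yElt) ^ 8) = 44264 := by
  classical
  rw [xElt_add_yElt, trace_sum_unit_pow, countP_surface_eq, ncard_surfaceWords_eight]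
  norm_num

theorem trace_freeSum : trace (freeSum ^ 8) = 44248 := by
  have h1 : freeSum = ((letters 4).map fun a => unit (FreeGroup.mk [a])).sum := by
    have h2 : ∀ i : Fin 4, unit (FreeGroup.of i)⁻¹ = unit (FreeGroup.mk [(i, false)]) :=
      fun _ => rfl
    have h3 : ∀ i : Fin 4, unit (FreeGroup.of i) = unit (FreeGroup.mk [(i, true)]) := fun _ => rfl
    rw [letters_four, freeSum, Fin.sum_univ_four]
    simp only [List.map_cons, List.map_nil, List.sum_cons, List.sum_nil, h2, h3]
    abel
  have h4 : ∀ w : List (Fin 4 × Bool), (w.map fun a => FreeGroup.mk [a]).prod = FreeGroup.mk w := by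
    intro w
    induction w with
    | nil => rfl
    | cons a w ih => rw [List.map_cons, List.prod_cons, ih, FreeGroup.mul_mk]; rfl
  classical
  rw [h1, trace_sum_unit_pow]
  simp only [h4]
  have h5 : ((44248 : ℕ) : ℂ) = 44248 := by norm_num
  rw [← h5, ← countP_free_eight]

theorem trace_incl_condExp {Γ : Type*} [Group Γ] (K : Subgroup Γ) (T : groupVN Γ) :
    trace (incl K (condExp K T)) = trace T := by
  rw [trace_eq_apply, trace_eq_apply]
  change blockDiag (coset K) (T : L2 Γ →L[ℂ] L2 Γ) (delta 1) 1 = _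
  rw [blockDiag_delta, if_pos rfl]

/-! ### The conditional expectation -/

/-- The conditional expectation onto `λ(K)''`, as a map of `L(Γ)` to itself. -/
def expect {Γ : Type*} [Group Γ] (K : Subgroup Γ) (T : groupVN Γ) : groupVN Γ :=
  incl K (condExp K T)

theorem expect_delta {Γ : Type*} [Group Γ] (K : Subgroup Γ) (T : groupVN Γ) (s t : Γ) :
    (expect K T : L2 Γ →L[ℂ] L2 Γ) (delta t) s =
      open scoped Classical in
      if s * t⁻¹ ∈ K then (T : L2 Γ →L[ℂ] L2 Γ) (delta t) s else 0 := by
  classical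
  change blockDiag (coset K) (T : L2 Γ →L[ℂ] L2 Γ) (delta t) s = _
  rw [blockDiag_delta]
  simp only [coset_eq]

theorem groupVN_ext {Γ : Type*} [Group Γ] {S T : groupVN Γ}
    (h : ∀ s t, (S : L2 Γ →L[ℂ] L2 Γ) (delta t) s = (T : L2 Γ →L[ℂ] L2 Γ) (delta t) s) : S = T :=
  Subtype.ext (op_ext h)

/-- The conditional expectation as a linear map of `L(Γ)` to itself. -/
def expectLin {Γ : Type*} [Group Γ] (K : Subgroup Γ) : groupVN Γ →ₗ[ℂ] groupVN Γ where
  toFun := expect K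
  map_add' S T := Subtype.ext (map_add (blockDiag (coset K)) (S : L2 Γ →L[ℂ] L2 Γ) T)
  map_smul' c T := Subtype.ext (map_smul (blockDiag (coset K)) c (T : L2 Γ →L[ℂ] L2 Γ))

theorem expectLin_apply {Γ : Type*} [Group Γ] (K : Subgroup Γ) (T : groupVN Γ) :
    expectLin K T = expect K T := rfl

theorem expect_expect {Γ : Type*} [Group Γ] (K : Subgroup Γ) (T : groupVN Γ) :
    expect K (expect K T) = expect K T := by
  refine groupVN_ext fun s t => ?_
  rw [expect_delta, expect_delta]
  split_ifs <;> rfl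

theorem trace_expect {Γ : Type*} [Group Γ] (K : Subgroup Γ) (T : groupVN Γ) :
    trace (expect K T) = trace T :=
  trace_incl_condExp K T

theorem mul_coe_delta_apply {Γ : Type*} [Group Γ] (S T : groupVN Γ) (s t : Γ)
    (σ : Equiv.Perm Γ) :
    ((S * T : groupVN Γ) : L2 Γ →L[ℂ] L2 Γ) (delta t) s =
      ∑' u, (T : L2 Γ →L[ℂ] L2 Γ) (delta t) (σ u) * (S : L2 Γ →L[ℂ] L2 Γ) (delta (σ u)) s :=
  mul_delta_apply _ _ s t σ

/-- The module property, read off matrix entries: Z lives on the entries with u t⁻¹ ∈ K, and for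
such u the conditions s u⁻¹ ∈ K and s t⁻¹ ∈ K agree. -/
theorem expect_mul_of_fixed {Γ : Type*} [Group Γ] (K : Subgroup Γ) (T Z : groupVN Γ)
    (hZ : expect K Z = Z) : expect K (T * Z) = expect K T * Z := by
  classical
  refine groupVN_ext fun s t => ?_
  rw [expect_delta, mul_coe_delta_apply _ _ _ _ (Equiv.refl _),
    mul_coe_delta_apply _ _ _ _ (Equiv.refl _), ← hZ]
  simp only [expect_delta, Equiv.refl_apply]
  have h : ∀ u, u * t⁻¹ ∈ K → (s * u⁻¹ ∈ K ↔ s * t⁻¹ ∈ K) := by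
    intro u hu
    have : s * t⁻¹ = s * u⁻¹ * (u * t⁻¹) := by group
    rw [this, K.mul_mem_cancel_right hu]
  by_cases hs : s * t⁻¹ ∈ K
  · rw [if_pos hs]
    refine tsum_congr fun u => ?_
    by_cases hu : u * t⁻¹ ∈ K
    · rw [if_pos hu, if_pos ((h u hu).2 hs)]
    · simp [hu]
  · rw [if_neg hs, eq_comm]
    refine (tsum_congr fun u => ?_).trans tsum_zero
    by_cases hu : u * t⁻¹ ∈ K
    · rw [if_neg (mt (h u hu).1 hs), mul_zero]
    · simp [hu]

/-- Entries depend only on s t⁻¹, so the substitution u ↦ u⁻¹ in the middle index exchanges the two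
factors. -/
theorem trace_mul_comm {Γ : Type*} [Group Γ] (S T : groupVN Γ) :
    trace (S * T) = trace (T * S) := by
  rw [trace_eq_apply, trace_eq_apply, mul_coe_delta_apply _ _ _ _ (Equiv.refl _),
    mul_coe_delta_apply _ _ _ _ (Equiv.inv Γ)]
  refine tsum_congr fun u => ?_
  simp only [Equiv.refl_apply, Equiv.inv_apply]
  rw [entry_of_mem T.2 1 u⁻¹, entry_of_mem S.2 1 u]
  simp [mul_comm]

theorem expect_unit {Γ : Type*} [Group Γ] (K : Subgroup Γ) (g : Γ) :
    expect K (unit g) = open scoped Classical in if g ∈ K then unit g else 0 := by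
  classical
  refine groupVN_ext fun s t => ?_
  rw [expect_delta]
  change (if s * t⁻¹ ∈ K then lam g (delta t) s else 0) = _
  rw [lam_delta, delta_apply]
  by_cases hs : s = g * t
  · subst hs
    by_cases hg : g ∈ K
    · simp only [mul_inv_cancel_right, hg, if_true]
      change _ = lam g (delta t) (g * t)
      rw [lam_delta, delta_apply, if_pos rfl]
    · simp only [mul_inv_cancel_right, hg, if_false]
      rfl
  · rw [if_neg hs, ite_self]
    by_cases hg : g ∈ K
    · rw [if_pos hg]
      change _ = lam g (delta t) s
      rw [lam_delta, delta_apply, if_neg hs]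
    · rw [if_neg hg]
      rfl

/-! ### The low moments of `x` -/

/-- The commutator `a b a⁻¹ b⁻¹` in the free group. -/
def comm : FreeGroup (Fin 2) := commHom (FreeGroup.of ())

theorem comm_eq_mk :
    comm = FreeGroup.mk [(0, true), (1, true), (0, false), (1, false)] := by
  rw [comm, commHom, FreeGroup.lift_apply_of]
  rfl

/-- The commutator is cyclically reduced, so its repetitions are already reduced words. Consequently
words of length n reach only the powers hᵏ with 4|k| ≤ n. -/
theorem norm_comm_pow (n : ℕ) : (comm ^ n).norm = 4 * n := by
  have hc : FreeGroup.IsCyclicallyReduced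
      [((0 : Fin 2), true), (1, true), (0, false), (1, false)] := by
    rw [FreeGroup.isCyclicallyReduced_iff, FreeGroup.isReduced_iff_reduce_eq]
    decide
  rw [comm_eq_mk, FreeGroup.pow_mk, FreeGroup.norm, FreeGroup.toWord_mk,
    (hc.flatten_replicate n).isReduced.reduce_eq]
  simp [mul_comm]

theorem norm_comm_zpow (n : ℤ) : (comm ^ n).norm = 4 * n.natAbs := by
  rcases Int.natAbs_eq n with h | h
  · rw [h, zpow_natCast, norm_comm_pow, Int.natAbs_natCast]
  · rw [h, zpow_neg, FreeGroup.norm_inv_eq, zpow_natCast, norm_comm_pow, Int.natAbs_neg,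
      Int.natAbs_natCast]

theorem mem_range_commHom_iff (g : FreeGroup (Fin 2)) :
    g ∈ commHom.range ↔ ∃ n : ℤ, comm ^ n = g := by
  constructor
  · rintro ⟨k, rfl⟩
    obtain ⟨n, rfl⟩ := FreeGroup.freeGroupUnitEquivInt.symm.surjective k
    exact ⟨n, (map_zpow commHom _ n).symm⟩
  · rintro ⟨n, rfl⟩
    exact commHom.range.zpow_mem ⟨_, rfl⟩ n

theorem emb_injective (i : Fin 2) : Function.Injective (emb i) :=
  Monoid.PushoutI.of_injective (fun _ => commHom_injective) i

theorem emb_mem_amalgSubgroup_iff (i : Fin 2) (g : FreeGroup (Fin 2)) :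
    emb i g ∈ amalgSubgroup ↔ ∃ n : ℤ, comm ^ n = g := by
  rw [← mem_range_commHom_iff]
  constructor
  · rintro ⟨k, hk⟩
    refine ⟨k, emb_injective i ?_⟩
    rw [← hk]
    exact Monoid.PushoutI.of_apply_eq_base (fun _ : Fin 2 => commHom) i k
  · rintro ⟨k, rfl⟩
    exact ⟨k, (Monoid.PushoutI.of_apply_eq_base (fun _ : Fin 2 => commHom) i k).symm⟩

theorem xElt_pow (n : ℕ) :
    xElt ^ n = ((words (letters 2) n).map fun w => unit (emb 0 (FreeGroup.mk w))).sum := by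
  have h1 : xElt = ((letters 2).map fun a => unit (emb 0 (FreeGroup.mk [a]))).sum := by
    have h2 : letters 2 = [(0, true), (0, false), (1, true), (1, false)] := by decide
    have h3 : ∀ i : Fin 2, unit (emb 0 (FreeGroup.mk [(i, false)])) =
        unit (emb 0 (FreeGroup.of i))⁻¹ := fun i => by rw [← map_inv]; rfl
    have h4 : ∀ i : Fin 2, unit (emb 0 (FreeGroup.mk [(i, true)])) =
        unit (emb 0 (FreeGroup.of i)) := fun i => rfl
    rw [h2, xElt]
    simp only [List.map_cons, List.map_nil, List.sum_cons, List.sum_nil, h3, h4]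
    simp only [letter, Matrix.cons_val_zero, Matrix.cons_val_one]
    abel
  have h5 : ∀ w : List (Fin 2 × Bool),
      (w.map fun a => emb 0 (FreeGroup.mk [a])).prod = emb 0 (FreeGroup.mk w) := by
    intro w
    induction w with
    | nil => exact (map_one (emb 0)).symm
    | cons a w ih => rw [List.map_cons, List.prod_cons, ih, ← map_mul, FreeGroup.mul_mk]; rfl
  rw [h1, sum_unit_pow]
  simp only [h5]

theorem trace_xElt_pow (n : ℕ) : trace (xElt ^ n) = (freeCount 2 n 0 : ℕ) := by
  classical
  rw [xElt_pow, ← traceLin_apply, map_list_sum, List.map_map, ← FreeGroup.norm_one (α := Fin 2),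
    ← countP_words_free, ← sum_map_ite_eq_countP]
  simp only [Function.comp_def, traceLin_apply, trace_unit, map_eq_one_iff (emb 0) (emb_injective 0)]

/-- The nested moments are formed with this expectation. -/
abbrev ex : AmalgAlg → AmalgAlg := expect amalgSubgroup

theorem ex_xElt_pow (n : ℕ) : ex (xElt ^ n) =
    open scoped Classical in
    ((words (letters 2) n).map fun w => if ∃ k : ℤ, comm ^ k = FreeGroup.mk w then
      unit (emb 0 (FreeGroup.mk w)) else 0).sum := by
  classical
  rw [xElt_pow, ex, ← expectLin_apply, map_list_sum, List.map_map]
  refine congrArg List.sum (List.map_congr_left fun w _ => ?_)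
  rw [Function.comp_apply, expectLin_apply, expect_unit]
  exact if_congr (emb_mem_amalgSubgroup_iff 0 _) rfl rfl

theorem natAbs_le_of_comm_zpow_eq {k : ℤ} {w : List (Fin 2 × Bool)}
    (h : comm ^ k = FreeGroup.mk w) : 4 * k.natAbs ≤ w.length := by
  rw [← norm_comm_zpow, h]
  exact FreeGroup.norm_mk_le

/-- No nontrivial power of h has length at most 2, so only the four words a a⁻¹, a⁻¹ a, b b⁻¹, b⁻¹ b
survive. -/
theorem ex_xElt_sq : ex (xElt ^ 2) = 4 := by
  classical
  have h : ∀ w ∈ words (letters 2) 2, (if ∃ k : ℤ, comm ^ k = FreeGroup.mk w then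
      unit (emb 0 (FreeGroup.mk w)) else 0) =
      if FreeGroup.mk w = 1 then (1 : AmalgAlg) else 0 := by
    intro w hw
    rw [mem_words mem_letters] at hw
    by_cases h1 : FreeGroup.mk w = 1
    · rw [if_pos ⟨0, by rw [h1, zpow_zero]⟩, if_pos h1, h1, map_one, unit_one]
    · rw [if_neg, if_neg h1]
      rintro ⟨k, hk⟩
      have := natAbs_le_of_comm_zpow_eq hk
      have hk0 : k = 0 := by omega
      exact h1 (by rw [← hk, hk0, zpow_zero])
  rw [ex_xElt_pow, List.map_congr_left h, sum_map_ite_eq_countP, countP_words_free,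
    FreeGroup.norm_one]
  have e : freeCount 2 2 0 = 4 := by decide
  rw [e, Nat.cast_ofNat]

theorem sum_map_ite_eq_nsmul {A R : Type*} [AddCommMonoid R] (l : List A) (p : A → Prop)
    [DecidablePred p] (c : R) :
    (l.map fun a => if p a then c else 0).sum = (l.countP fun a => decide (p a)) • c := by
  induction l with
  | nil => simp
  | cons a l ih => by_cases h : p a <;> simp [h, ih, add_smul, add_comm]

theorem norm_comm : comm.norm = 4 := by
  simpa using norm_comm_pow 1

theorem comm_ne_one : comm ≠ 1 := fun h => by
  have := norm_comm
  rw [h, FreeGroup.norm_one] at this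
  omega

/-- Length 4 is the first at which h and h⁻¹ appear, each spelled by exactly one word. This is the
only place where the amalgamation affects the moments of x needed below. -/
theorem ex_xElt_pow_four :
    ex (xElt ^ 4) = 28 • 1 + (unit (emb 0 comm) + unit (emb 0 comm⁻¹)) := by
  classical
  -- Needed so that the indicator terms of h and h⁻¹ below do not overlap.
  have hne : comm⁻¹ ≠ comm := fun h => by
    have h2 : comm ^ 2 = 1 := by rw [pow_two]; nth_rw 1 [← h]; exact inv_mul_cancel _
    have := norm_comm_pow 2
    rw [h2, FreeGroup.norm_one] at this
    omega
  have h : ∀ w ∈ words (letters 2) 4, (if ∃ k : ℤ, comm ^ k = FreeGroup.mk w then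
      unit (emb 0 (FreeGroup.mk w)) else 0) =
      (if FreeGroup.mk w = 1 then (1 : AmalgAlg) else 0) +
      ((if FreeGroup.mk w = comm then unit (emb 0 comm) else 0) +
      (if FreeGroup.mk w = comm⁻¹ then unit (emb 0 comm⁻¹) else 0)) := by
    intro w hw
    rw [mem_words mem_letters] at hw
    by_cases h1 : FreeGroup.mk w = 1
    · rw [if_pos ⟨0, by rw [h1, zpow_zero]⟩, if_pos h1, h1, if_neg comm_ne_one.symm,
        if_neg (inv_ne_one.2 comm_ne_one).symm, map_one, unit_one, add_zero, add_zero]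
    by_cases h2 : FreeGroup.mk w = comm
    · rw [if_pos ⟨1, by rw [h2, zpow_one]⟩, if_neg h1, if_pos h2, h2, if_neg hne.symm, zero_add,
        add_zero]
    by_cases h3 : FreeGroup.mk w = comm⁻¹
    · rw [if_pos ⟨-1, by rw [h3, zpow_neg_one]⟩, if_neg h1, if_neg h2, if_pos h3, h3, zero_add,
        zero_add]
    rw [if_neg, if_neg h1, if_neg h2, if_neg h3, zero_add, zero_add]
    rintro ⟨k, hk⟩
    have := natAbs_le_of_comm_zpow_eq hk
    have hk0 : k = 0 ∨ k = 1 ∨ k = -1 := by omega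
    rcases hk0 with rfl | rfl | rfl
    · exact h1 (by rw [← hk, zpow_zero])
    · exact h2 (by rw [← hk, zpow_one])
    · exact h3 (by rw [← hk, zpow_neg_one])
  rw [ex_xElt_pow, List.map_congr_left h, List.sum_map_add, List.sum_map_add,
    sum_map_ite_eq_nsmul, sum_map_ite_eq_nsmul, sum_map_ite_eq_nsmul, countP_words_free,
    countP_words_free, countP_words_free, FreeGroup.norm_inv_eq, FreeGroup.norm_one, norm_comm]
  have e1 : freeCount 2 4 0 = 28 := by decide
  have e2 : freeCount 2 4 4 = 1 := by decide
  rw [e1, e2, one_smul, one_smul]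

theorem trace_one {Γ : Type*} [Group Γ] : trace (1 : groupVN Γ) = 1 := by
  rw [← unit_one, trace_unit, if_pos rfl]

/-- Here 786 = 28² + 2, the 2 coming from h h⁻¹ and h⁻¹ h. -/
theorem trace_ex_xElt_pow_four_sq : trace (ex (xElt ^ 4) * ex (xElt ^ 4)) = 786 := by
  classical
  have h0 : ∀ g : FreeGroup (Fin 2), g ≠ 1 → traceLin SurfaceGroup (unit (emb 0 g)) = 0 := by
    intro g hg
    rw [traceLin_apply, trace_unit, if_neg]
    rwa [map_eq_one_iff (emb 0) (emb_injective 0)]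
  have h1 : traceLin SurfaceGroup 1 = 1 := trace_one
  have h2 : comm * comm ≠ 1 := fun h => by
    have := norm_comm_pow 2
    rw [pow_two, h, FreeGroup.norm_one] at this
    omega
  have h3 : comm⁻¹ * comm⁻¹ ≠ 1 := by
    rw [← mul_inv_rev]
    exact inv_ne_one.2 h2
  rw [ex_xElt_pow_four, ← traceLin_apply]
  simp only [add_mul, mul_add, smul_mul_assoc, mul_smul_comm, one_mul, mul_one, ← unit_mul,
    ← map_mul (emb 0), map_add, map_nsmul, mul_inv_cancel, inv_mul_cancel, h0 _ comm_ne_one,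
    h0 _ (inv_ne_one.2 comm_ne_one), h0 _ h2, h0 _ h3, map_one (emb 0), unit_one, h1]
  norm_num

/-! ### Symbolic evaluation of the nested moments of `x` -/

/-- Symbolic products: `power c i` stands for `c xⁱ`, `insert c i j` for `c xⁱ E(x⁴) xʲ`, and
`fixed c i j` for any `xⁱ Z xʲ` with `E(Z) = Z` and `τ(Z) = c`. -/
inductive Entry
  | power (c i : ℕ)
  | insert (c i j : ℕ)
  | fixed (c i j : ℕ)

/-- The symbolic product stands for the given element. -/
def Entry.Denotes : Entry → AmalgAlg → Prop
  | power c i, T => T = c • xElt ^ i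
  | insert c i j, T => T = c • (xElt ^ i * ex (xElt ^ 4) * xElt ^ j)
  | fixed c i j, T => ∃ Z, ex Z = Z ∧ trace Z = c ∧ T = xElt ^ i * Z * xElt ^ j

/-- Multiplication by `x` from the right. -/
def Entry.mulX : Entry → Entry
  | power c i => power c (i + 1)
  | insert c i j => insert c i (j + 1)
  | fixed c i j => fixed c i (j + 1)

/-- The expectation, where it is known. -/
def Entry.expect : Entry → Option Entry
  | power c 2 => some (power (4 * c) 0)
  | power c 4 => some (insert c 0 0)
  | power c 6 => some (fixed (232 * c) 0 0)
  | power c 8 => some (fixed (2092 * c) 0 0)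
  | insert c 1 1 => some (fixed (112 * c) 0 0)
  | insert c i j => if i + j = 4 then some (fixed (786 * c) 0 0) else none
  | fixed c 1 1 => some (fixed (4 * c) 0 0)
  | _ => none

/-- The product, where it is known. -/
def Entry.mul : Entry → Entry → Option Entry
  | power c i, power c' 0 => some (power (c * c') i)
  | insert c i j, power c' 0 => some (insert (c * c') i j)
  | fixed c i j, power c' 0 => some (fixed (c * c') i j)
  | power c i, insert c' 0 0 => some (insert (c * c') i 0)
  | power c i, fixed c' 0 0 => some (fixed (c * c') i 0)
  | insert c 0 0, insert c' 0 0 => some (fixed (786 * (c * c')) 0 0)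
  | _, _ => none

/-- The trace, where it is known. -/
def Entry.trace : Entry → Option ℕ
  | power c 0 => some c
  | insert c 0 0 => some (28 * c)
  | fixed c 0 0 => some c
  | _ => none

/-! ### Soundness of the symbolic rules -/

theorem ex_nsmul (n : ℕ) (T : AmalgAlg) : ex (n • T) = n • ex T := by
  rw [ex, ← expectLin_apply, map_nsmul, expectLin_apply]

theorem trace_nsmul {Γ : Type*} [Group Γ] (n : ℕ) (T : groupVN Γ) :
    trace (n • T) = n * trace T := by
  rw [← traceLin_apply, map_nsmul, traceLin_apply, nsmul_eq_mul]

/-- Traciality collects the powers of x on one side of Z, and the module property then lets E act on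
them alone. Thus the trace depends only on i + j. -/
theorem trace_pow_mul_mul_pow (Z : AmalgAlg) (i j : ℕ) (hZ : ex Z = Z) :
    trace (xElt ^ i * Z * xElt ^ j) = trace (ex (xElt ^ (i + j)) * Z) := by
  rw [trace_mul_comm, ← mul_assoc, ← pow_add, ← trace_expect amalgSubgroup,
    expect_mul_of_fixed _ _ _ hZ, add_comm]

/-- E(x²) is the scalar 4, so only the trace of Z matters. -/
theorem trace_mul_fixed_mul (Z : AmalgAlg) (hZ : ex Z = Z) :
    trace (xElt ^ 1 * Z * xElt ^ 1) = 4 * trace Z := by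
  have h : (4 : AmalgAlg) * Z = 4 • Z := by simp
  rw [trace_pow_mul_mul_pow Z 1 1 hZ, ex_xElt_sq, h, trace_nsmul]
  norm_num

theorem trace_ex_xElt_pow (n : ℕ) : trace (ex (xElt ^ n)) = (freeCount 2 n 0 : ℕ) := by
  rw [trace_expect, trace_xElt_pow]

theorem Entry.denotes_mulX {e : Entry} {T : AmalgAlg} (h : e.Denotes T) :
    e.mulX.Denotes (T * xElt) := by
  cases e with
  | power c i => rw [mulX, Denotes, h, smul_mul_assoc, ← pow_succ]
  | insert c i j => rw [mulX, Denotes, h, smul_mul_assoc, mul_assoc (_ * _), ← pow_succ]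
  | fixed c i j =>
    obtain ⟨Z, h1, h2, rfl⟩ := h
    exact ⟨Z, h1, h2, by rw [mul_assoc (_ * _), ← pow_succ]⟩

theorem Entry.denotes_expect {e e' : Entry} {T : AmalgAlg} (h : e.Denotes T)
    (he : e.expect = some e') : e'.Denotes (ex T) := by
  -- For expectations whose exact value is not tracked, the trace and invariance under E are all
  -- that is recorded.
  have hfix : ∀ c : ℕ, FreeAmalgam.trace T = c → (fixed c 0 0).Denotes (ex T) := fun c hc =>
    ⟨ex T, expect_expect _ _, by rw [trace_expect, hc], by simp⟩
  unfold expect at he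
  split at he
  · obtain rfl := Option.some.inj he
    rw [h, Denotes, ex_nsmul, ex_xElt_sq, pow_zero, mul_comm, mul_smul]
    simp
  · obtain rfl := Option.some.inj he
    rw [h, Denotes, ex_nsmul]
    simp
  · obtain rfl := Option.some.inj he
    refine hfix _ ?_
    have : freeCount 2 6 0 = 232 := by decide
    rw [h, trace_nsmul, trace_xElt_pow, this]
    push_cast; ring
  · obtain rfl := Option.some.inj he
    refine hfix _ ?_
    have : freeCount 2 8 0 = 2092 := by decide
    rw [h, trace_nsmul, trace_xElt_pow, this]
    push_cast; ring
  · obtain rfl := Option.some.inj he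
    refine hfix _ ?_
    have : freeCount 2 4 0 = 28 := by decide
    rw [h, trace_nsmul, trace_mul_fixed_mul _ (expect_expect _ _), trace_ex_xElt_pow, this]
    push_cast; ring
  · split_ifs at he with hij
    obtain rfl := Option.some.inj he
    refine hfix _ ?_
    rw [h, trace_nsmul, trace_pow_mul_mul_pow _ _ _ (expect_expect _ _), hij,
      trace_ex_xElt_pow_four_sq]
    push_cast; ring
  · obtain rfl := Option.some.inj he
    refine hfix _ ?_
    obtain ⟨Z, h1, h2, rfl⟩ := h
    rw [trace_mul_fixed_mul Z h1, h2]
    push_cast; ring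
  · cases he

theorem Entry.denotes_mul {e e' e'' : Entry} {S T : AmalgAlg} (h : e.Denotes S)
    (h' : e'.Denotes T) (he : e.mul e' = some e'') : e''.Denotes (S * T) := by
  unfold mul at he
  split at he
  · obtain rfl := Option.some.inj he
    rw [h, h', Denotes, pow_zero, smul_mul_smul_comm, mul_one]
  · obtain rfl := Option.some.inj he
    rw [h, h', Denotes, pow_zero, smul_mul_smul_comm, mul_one]
  · obtain rfl := Option.some.inj he
    obtain ⟨Z, h1, h2, rfl⟩ := h
    rename_i c i j c'
    refine ⟨c' • Z, by rw [ex_nsmul, h1], by rw [trace_nsmul, h2]; push_cast; ring, ?_⟩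
    rw [h', pow_zero, mul_smul_comm, mul_one, mul_smul_comm, smul_mul_assoc]
  · obtain rfl := Option.some.inj he
    rw [h, h', Denotes, smul_mul_smul_comm]
    simp
  · obtain rfl := Option.some.inj he
    obtain ⟨Z, h1, h2, rfl⟩ := h'
    rename_i c i c'
    refine ⟨c • Z, by rw [ex_nsmul, h1], by rw [trace_nsmul, h2]; push_cast; ring, ?_⟩
    rw [h, pow_zero, one_mul, mul_one, mul_one, smul_mul_assoc, mul_smul_comm]
  · obtain rfl := Option.some.inj he
    rename_i c c'
    -- The product of two expectations is again fixed by E, by the module property, so it may be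
    -- recorded by its trace alone.
    refine ⟨(c * c') • (ex (xElt ^ 4) * ex (xElt ^ 4)), ?_, ?_, ?_⟩
    · rw [ex_nsmul, ex, expect_mul_of_fixed _ _ _ (expect_expect _ _), expect_expect]
    · rw [trace_nsmul, trace_ex_xElt_pow_four_sq]; push_cast; ring
    · rw [h, h', smul_mul_smul_comm]
      simp only [pow_zero, one_mul, mul_one]
  · cases he

theorem Entry.denotes_trace {e : Entry} {T : AmalgAlg} {m : ℕ} (h : e.Denotes T)
    (he : e.trace = some m) : FreeAmalgam.trace T = m := by
  unfold trace at he
  split at he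
  · obtain rfl := Option.some.inj he
    rw [h, pow_zero, trace_nsmul, trace_one, mul_one]
  · obtain rfl := Option.some.inj he
    have : freeCount 2 4 0 = 28 := by decide
    rw [h, pow_zero, one_mul, mul_one, trace_nsmul, trace_ex_xElt_pow, this]
    push_cast; ring
  · obtain rfl := Option.some.inj he
    obtain ⟨Z, h1, h2, rfl⟩ := h
    rw [pow_zero, one_mul, mul_one, h2]
  · cases he

/-- Multiply the innermost open product by a factor. -/
def mulTop {A : Type*} [Ring A] (x : A) : List A → List A
  | t :: r => (t * x) :: r
  | [] => []

/-- Close the innermost open product. -/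
def closeTop {A : Type*} [Ring A] (E : A → A) : List A → List A
  | t :: u :: r => (u * E t) :: r
  | r => r

/-- Separates the opening and the closing of a block and replaces the two conditions by Booleans,
the form that the symbolic evaluator can follow. -/
theorem nestStep_eq {A : Type*} [Ring A] (E : A → A) {n : ℕ} (a : Fin n → A) (π : NC n)
    (S : List A) (k : Fin n) {first last : Bool} (hf : first = true ↔ ∀ j ∈ π.1.part k, k ≤ j)
    (hl : last = true ↔ ∀ j ∈ π.1.part k, j ≤ k) :
    nestStep E a π S k =
      (bif last then closeTop E else id) (bif first then a k :: S else mulTop (a k) S) := by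
  unfold nestStep
  simp only [← hf, ← hl]
  cases first <;> cases last <;> rcases S with _ | ⟨t, _ | ⟨u, S⟩⟩ <;> rfl

/-- The symbolic form of `mulTop`. -/
def symMulTop : List Entry → List Entry
  | t :: r => t.mulX :: r
  | [] => []

/-- The symbolic form of `closeTop`. -/
def symCloseTop : List Entry → Option (List Entry)
  | t :: u :: r => t.expect.bind fun e => (u.mul e).bind fun v => some (v :: r)
  | r => some r

/-- The symbolic form of `nestStep`. -/
def symStep (first last : Bool) (S : List Entry) : Option (List Entry) :=
  (bif last then symCloseTop else some) (bif first then Entry.power 1 1 :: S else symMulTop S)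

theorem denotes_symCloseTop {S S' : List Entry} {T : List AmalgAlg}
    (h : List.Forall₂ Entry.Denotes S T) (hS : symCloseTop S = some S') :
    List.Forall₂ Entry.Denotes S' (closeTop ex T) := by
  cases h with
  | nil => rw [← Option.some.inj hS]; exact List.Forall₂.nil
  | cons h1 h =>
    cases h with
    | nil => rw [← Option.some.inj hS]; exact List.Forall₂.cons h1 List.Forall₂.nil
    | cons h2 h =>
      obtain ⟨e, he, hS⟩ := Option.bind_eq_some_iff.1 hS
      obtain ⟨v, hv, hS⟩ := Option.bind_eq_some_iff.1 hS
      rw [← Option.some.inj hS]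
      exact List.Forall₂.cons (Entry.denotes_mul h2 (Entry.denotes_expect h1 he) hv) h

theorem denotes_symStep {n : ℕ} (π : NC n) (k : Fin n) {first last : Bool}
    (hf : first = true ↔ ∀ j ∈ π.1.part k, k ≤ j) (hl : last = true ↔ ∀ j ∈ π.1.part k, j ≤ k)
    {S S' : List Entry} {T : List AmalgAlg} (h : List.Forall₂ Entry.Denotes S T)
    (hS : symStep first last S = some S') :
    List.Forall₂ Entry.Denotes S' (nestStep ex (fun _ => xElt) π T k) := by
  rw [nestStep_eq ex _ π T k hf hl]
  have h1 : List.Forall₂ Entry.Denotes (bif first then Entry.power 1 1 :: S else symMulTop S)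
      (bif first then xElt :: T else mulTop xElt T) := by
    cases first with
    | false =>
      cases h with
      | nil => exact List.Forall₂.nil
      | cons h1 h2 => exact List.Forall₂.cons (Entry.denotes_mulX h1) h2
    | true => exact List.Forall₂.cons (by simp [Entry.Denotes]) h
  cases last with
  | false => rwa [← Option.some.inj hS]
  | true => exact denotes_symCloseTop h1 hS

/-- The symbolic evaluation of a nested moment of `x`, for the partition of `{1, …, n}` into the
fibres of a map. -/
def symMoment {n : ℕ} (r : Fin n → Fin n) : Option ℕ :=
  ((List.finRange n).foldlM (fun S k => symStep (decide (∀ j, r j = r k → k ≤ j))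
    (decide (∀ j, r j = r k → j ≤ k)) S) [Entry.power 1 0]).bind fun S =>
      S.head?.bind Entry.trace

/-- Soundness of the evaluator: each step keeps every entry of the symbolic stack denoting the
corresponding entry of the true one, starting from 1 = x⁰. -/
theorem trace_psi_of_symMoment {n : ℕ} (π : NC n) (r : Fin n → Fin n)
    (hr : ∀ j k, r j = r k ↔ j ∈ π.1.part k) {m : ℕ} (hm : symMoment r = some m) :
    trace (psi π) = m := by
  obtain ⟨S, hS, hm⟩ := Option.bind_eq_some_iff.1 hm
  obtain ⟨e, he, hm⟩ := Option.bind_eq_some_iff.1 hm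
  have key : ∀ (l : List (Fin n)) (U U' : List Entry) (V : List AmalgAlg),
      List.Forall₂ Entry.Denotes U V →
      l.foldlM (fun S k => symStep (decide (∀ j, r j = r k → k ≤ j))
        (decide (∀ j, r j = r k → j ≤ k)) S) U = some U' →
      List.Forall₂ Entry.Denotes U' (l.foldl (nestStep ex (fun _ => xElt) π) V) := by
    intro l
    induction l with
    | nil =>
      intro U U' V h h'
      rw [List.foldlM_nil] at h'
      rw [← Option.some.inj h']
      exact h
    | cons k l ih =>
      intro U U' V h h'
      rw [List.foldlM_cons] at h'
      obtain ⟨W, hW, h'⟩ := Option.bind_eq_some_iff.1 h'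
      refine ih W U' _ (denotes_symStep π k ?_ ?_ h hW) h'
      · simp only [decide_eq_true_eq, hr]
      · simp only [decide_eq_true_eq, hr]
  have h := key _ _ _ [1] (List.Forall₂.cons (by simp [Entry.Denotes]) List.Forall₂.nil) hS
  change trace ((List.foldl (nestStep ex (fun _ => xElt) π) [1] (List.finRange n)).headD 1) = m
  generalize List.foldl (nestStep ex (fun _ => xElt) π) [1] (List.finRange n) = V at h
  cases h with
  | nil => cases he
  | cons h1 h2 =>
    obtain rfl := Option.some.inj he
    exact Entry.denotes_trace h1 hm

/-! ### Enumeration of the even noncrossing partitions -/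

/-- Whether the value `v` at `n` extends the list `l` of the minima of the blocks of
`0, …, n - 1` to a noncrossing partition. -/
def extendsCode (l : List ℕ) (n v : ℕ) : Bool :=
  (Nat.beq v n || Nat.beq (l.getD v 0) v) &&
    (List.range n).all fun j => !(Nat.blt (l.getD j 0) v && Nat.blt v j)

/-- The noncrossing partitions of `{0, …, n - 1}`, each given by the list of the minima of the
blocks of its elements. -/
def ncCodes : ℕ → List (List ℕ)
  | 0 => [[]]
  | n + 1 => (ncCodes n).flatMap fun l =>
      ((List.range (n + 1)).filter (extendsCode l n)).map fun v => l ++ [v]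

/-- The noncrossing partitions of `{0, …, 7}` with blocks of even size. -/
def evenCodes : List (List ℕ) :=
  [[0, 0, 0, 0, 0, 0, 0, 0], [0, 0, 0, 0, 0, 0, 6, 6], [0, 0, 0, 0, 0, 5, 5, 0],
    [0, 0, 0, 0, 4, 4, 0, 0], [0, 0, 0, 0, 4, 4, 4, 4], [0, 0, 0, 0, 4, 4, 6, 6],
    [0, 0, 0, 0, 4, 5, 5, 4], [0, 0, 0, 3, 3, 0, 0, 0], [0, 0, 0, 3, 3, 0, 6, 6],
    [0, 0, 0, 3, 3, 3, 3, 0], [0, 0, 0, 3, 3, 5, 5, 0], [0, 0, 0, 3, 4, 4, 3, 0],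
    [0, 0, 2, 2, 0, 0, 0, 0], [0, 0, 2, 2, 0, 0, 6, 6], [0, 0, 2, 2, 0, 5, 5, 0],
    [0, 0, 2, 2, 2, 2, 0, 0], [0, 0, 2, 2, 2, 2, 2, 2], [0, 0, 2, 2, 2, 2, 6, 6],
    [0, 0, 2, 2, 2, 5, 5, 2], [0, 0, 2, 2, 4, 4, 0, 0], [0, 0, 2, 2, 4, 4, 2, 2],
    [0, 0, 2, 2, 4, 4, 4, 4], [0, 0, 2, 2, 4, 4, 6, 6], [0, 0, 2, 2, 4, 5, 5, 4],
    [0, 0, 2, 3, 3, 2, 0, 0], [0, 0, 2, 3, 3, 2, 2, 2], [0, 0, 2, 3, 3, 2, 6, 6],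
    [0, 0, 2, 3, 3, 3, 3, 2], [0, 0, 2, 3, 3, 5, 5, 2], [0, 0, 2, 3, 4, 4, 3, 2],
    [0, 1, 1, 0, 0, 0, 0, 0], [0, 1, 1, 0, 0, 0, 6, 6], [0, 1, 1, 0, 0, 5, 5, 0],
    [0, 1, 1, 0, 4, 4, 0, 0], [0, 1, 1, 0, 4, 4, 4, 4], [0, 1, 1, 0, 4, 4, 6, 6],
    [0, 1, 1, 0, 4, 5, 5, 4], [0, 1, 1, 1, 1, 0, 0, 0], [0, 1, 1, 1, 1, 0, 6, 6],
    [0, 1, 1, 1, 1, 1, 1, 0], [0, 1, 1, 1, 1, 5, 5, 0], [0, 1, 1, 1, 4, 4, 1, 0],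
    [0, 1, 1, 3, 3, 0, 0, 0], [0, 1, 1, 3, 3, 0, 6, 6], [0, 1, 1, 3, 3, 1, 1, 0],
    [0, 1, 1, 3, 3, 3, 3, 0], [0, 1, 1, 3, 3, 5, 5, 0], [0, 1, 1, 3, 4, 4, 3, 0],
    [0, 1, 2, 2, 1, 0, 0, 0], [0, 1, 2, 2, 1, 0, 6, 6], [0, 1, 2, 2, 1, 1, 1, 0],
    [0, 1, 2, 2, 1, 5, 5, 0], [0, 1, 2, 2, 2, 2, 1, 0], [0, 1, 2, 2, 4, 4, 1, 0],
    [0, 1, 2, 3, 3, 2, 1, 0]]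

/-- All values of the list are taken an even number of times. -/
def evenCounts (l : List ℕ) : Bool :=
  (List.range 8).all fun v =>
    Nat.beq (Nat.mod (l.countP fun u => Nat.beq u v) 2) 0

theorem filter_ncCodes_eight : (ncCodes 8).filter evenCounts = evenCodes := by
  decide +kernel

/-- Completeness of the enumeration. The converse is not needed, since `codeFun_spec` checks the
listed even codes directly. -/
theorem mem_ncCodes (r : ℕ → ℕ) (h1 : ∀ k, r k ≤ k) (h2 : ∀ k, r (r k) = r k)
    (h3 : ∀ j k, j < k → r j < r k → ¬ r k < j) (n : ℕ) :
    (List.range n).map r ∈ ncCodes n := by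
  induction n with
  | zero => simp [ncCodes]
  | succ n ih =>
    rw [ncCodes, List.mem_flatMap]
    refine ⟨_, ih, ?_⟩
    rw [List.mem_map]
    refine ⟨r n, ?_, by rw [List.range_succ, List.map_append, List.map_singleton]⟩
    have hget : ∀ j < n, ((List.range n).map r).getD j 0 = r j := by
      intro j hj
      simp [List.getD_eq_getElem?_getD, hj]
    rw [List.mem_filter, List.mem_range, extendsCode, Bool.and_eq_true, Bool.or_eq_true,
      List.all_eq_true]
    refine ⟨Nat.lt_succ_of_le (h1 n), ?_, ?_⟩
    · rcases (h1 n).eq_or_lt with h | h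
      · left; simpa using h
      · right; rw [hget _ h, h2]; simp
    · intro j hj
      rw [List.mem_range] at hj
      rw [hget j hj]
      have := h3 j n hj
      simp only [Bool.not_eq_true', ← Bool.not_eq_true, Bool.and_eq_true, Nat.blt_eq]
      exact fun h => this h.1 h.2

/-- The map given by a list of values. -/
def codeFun (l : List ℕ) (k : Fin 8) : Fin 8 := Fin.ofNat 8 (l.getD k 0)

theorem codeFun_spec : ∀ l ∈ evenCodes, (∀ k, codeFun l k ≤ k) ∧
    (∀ k, codeFun l (codeFun l k) = codeFun l k) ∧
    (∀ j k, j < k → codeFun l j < codeFun l k → ¬ codeFun l k < j) ∧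
    ∀ k, Even (Finset.univ.filter fun j => codeFun l j = k).card := by
  decide +kernel

theorem nodup_map_codeFun : (evenCodes.map codeFun).Nodup := by
  decide +kernel

/-! ### Noncrossing partitions and their block minima -/

/-- The minimum of the block of `k`. -/
def blockMin {n : ℕ} (π : NC n) (k : Fin n) : Fin n :=
  (π.1.part k).min' ⟨k, π.1.mem_part_self.2 (Finset.mem_univ k)⟩

theorem blockMin_mem {n : ℕ} (π : NC n) (k : Fin n) : blockMin π k ∈ π.1.part k :=
  Finset.min'_mem _ _

theorem blockMin_eq_iff {n : ℕ} (π : NC n) (j k : Fin n) :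
    blockMin π j = blockMin π k ↔ j ∈ π.1.part k := by
  have h : j ∈ π.1.part k ↔ π.1.part j = π.1.part k :=
    π.1.mem_part_iff_part_eq_part (Finset.mem_univ j) (Finset.mem_univ k)
  rw [h]
  constructor
  · intro hjk
    have h1 := blockMin_mem π j
    have h2 := blockMin_mem π k
    rw [hjk] at h1
    rw [π.1.mem_part_iff_part_eq_part (Finset.mem_univ _) (Finset.mem_univ _)] at h1 h2
    rw [← h1, h2]
  · intro hjk
    simp only [blockMin, hjk]

theorem blockMin_le {n : ℕ} (π : NC n) {j k : Fin n} (h : j ∈ π.1.part k) : blockMin π k ≤ j :=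
  Finset.min'_le _ _ h

theorem blockMin_le_self {n : ℕ} (π : NC n) (k : Fin n) : blockMin π k ≤ k :=
  blockMin_le π ((blockMin_eq_iff π k k).1 rfl)

theorem blockMin_blockMin {n : ℕ} (π : NC n) (k : Fin n) :
    blockMin π (blockMin π k) = blockMin π k :=
  (blockMin_eq_iff π _ _).2 (blockMin_mem π k)

theorem part_mem_parts {n : ℕ} (π : NC n) (k : Fin n) : π.1.part k ∈ π.1.parts :=
  π.1.part_mem.2 (Finset.mem_univ k)

/-- Otherwise the two minima followed by j and k would form a crossing. -/
theorem not_blockMin_crossing {n : ℕ} (π : NC n) {j k : Fin n} (hjk : j < k)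
    (h : blockMin π j < blockMin π k) : ¬ blockMin π k < j := by
  intro h'
  have := π.2 _ (part_mem_parts π j) _ (part_mem_parts π k) _ (blockMin_mem π j) _
    (blockMin_mem π k) j ((blockMin_eq_iff π j j).1 rfl) k ((blockMin_eq_iff π k k).1 rfl) h h' hjk
  have h2 : j ∈ π.1.part k := this ▸ (blockMin_eq_iff π j j).1 rfl
  exact h.ne ((blockMin_eq_iff π j k).2 h2)

/-- Expresses refinement through block minima alone, so that it can be decided by computation on
codes. -/
theorem le_iff_blockMin {n : ℕ} (π θ : NC n) :
    π ≤ θ ↔ ∀ k, blockMin θ (blockMin π k) = blockMin θ k := by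
  constructor
  · intro h k
    obtain ⟨c, hc, hle⟩ := h (part_mem_parts π k)
    have h1 : blockMin π k ∈ c := hle (blockMin_mem π k)
    have h2 : k ∈ c := hle ((blockMin_eq_iff π k k).1 rfl)
    rw [blockMin_eq_iff, θ.1.part_eq_of_mem hc h2]
    exact h1
  · intro h b hb
    obtain ⟨k, hk⟩ := π.1.nonempty_of_mem_parts hb
    refine ⟨θ.1.part k, part_mem_parts θ k, fun j hj => ?_⟩
    rw [← π.1.part_eq_of_mem hb hk, ← blockMin_eq_iff] at hj
    rw [← blockMin_eq_iff, ← h j, hj, h k]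

theorem blockMin_injective {n : ℕ} :
    Function.Injective (blockMin : NC n → Fin n → Fin n) := by
  intro π θ h
  refine le_antisymm ?_ ?_
  · rw [le_iff_blockMin, ← h]
    exact blockMin_blockMin π
  · rw [le_iff_blockMin, h]
    exact blockMin_blockMin θ

theorem card_parts {n : ℕ} (π : NC n) :
    π.1.parts.card = (Finset.univ.filter fun k => blockMin π k = k).card := by
  symm
  refine Finset.card_nbij π.1.part (fun k _ => part_mem_parts π k) ?_ ?_
  · intro j hj k hk hjk
    simp only [Finset.coe_filter, Finset.mem_univ, true_and, Set.mem_ofPred_eq] at hj hk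
    rw [← hj, ← hk, blockMin_eq_iff, ← hjk]
    exact (blockMin_eq_iff π j j).1 rfl
  · intro b hb
    obtain ⟨k, hk⟩ := π.1.nonempty_of_mem_parts hb
    refine ⟨blockMin π k, by simp [blockMin_blockMin], ?_⟩
    rw [← π.1.part_eq_of_mem hb hk]
    exact (π.1.mem_part_iff_part_eq_part (Finset.mem_univ _) (Finset.mem_univ _)).1
      (blockMin_mem π k)

theorem isEven_iff_blockMin {n : ℕ} (π : NC n) :
    IsEven π ↔ ∀ k, Even (Finset.univ.filter fun j => blockMin π j = k).card := by
  constructor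
  · intro h k
    by_cases hk : ∃ i, blockMin π i = k
    · obtain ⟨i, rfl⟩ := hk
      have : (Finset.univ.filter fun j => blockMin π j = blockMin π i) = π.1.part i := by
        ext j
        simp [blockMin_eq_iff]
      rw [this]
      exact h _ (part_mem_parts π i)
    · push Not at hk
      rw [Finset.filter_false_of_mem fun i _ => hk i]
      simp
  · intro h b hb
    obtain ⟨k, hk⟩ := π.1.nonempty_of_mem_parts hb
    have : (Finset.univ.filter fun j => blockMin π j = blockMin π k) = b := by
      ext j
      simp [blockMin_eq_iff, π.1.part_eq_of_mem hb hk]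
    rw [← this]
    exact h _

/-- Each block of the coarser partition is a disjoint union of even blocks. This makes the even
partitions an upper set, as the Möbius inversion requires. -/
theorem IsEven.mono {n : ℕ} {π θ : NC n} (h : π ≤ θ) (hπ : IsEven π) : IsEven θ := by
  rw [isEven_iff_blockMin] at hπ ⊢
  rw [le_iff_blockMin] at h
  intro k
  rw [Finset.card_eq_sum_card_fiberwise (f := blockMin π) (t := Finset.univ) fun _ _ => by simp]
  refine Finset.even_sum _ fun v _ => ?_
  by_cases hv : blockMin θ v = k
  · have h1 : (Finset.univ.filter fun j => blockMin θ j = k).filter (fun j => blockMin π j = v) =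
        Finset.univ.filter fun j => blockMin π j = v := by
      ext j
      simp only [Finset.mem_filter, Finset.mem_univ, true_and, and_iff_right_iff_imp]
      rintro rfl
      rw [← hv, h]
    rw [h1]
    exact hπ v
  · rw [Finset.filter_false_of_mem]
    · simp
    · intro j hj hjv
      rw [Finset.mem_filter] at hj
      rw [← hjv, h] at hv
      exact hv hj.2

theorem exists_blockMin_eq {n : ℕ} (r : Fin n → Fin n) (h1 : ∀ k, r k ≤ k)
    (h2 : ∀ k, r (r k) = r k) (h3 : ∀ j k, j < k → r j < r k → ¬ r k < j) :
    ∃ π : NC n, blockMin π = r := by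
  classical
  let P := Finpartition.ofSetoid (Setoid.ker r)
  have hP : ∀ j k, j ∈ P.part k ↔ r j = r k := by
    intro j k
    rw [Finpartition.mem_part_ofSetoid_iff_rel, Setoid.ker_def, eq_comm]
  have hP' : ∀ V ∈ P.parts, ∀ i ∈ V, ∀ j, j ∈ V ↔ r j = r i := by
    intro V hV i hi j
    rw [← hP, P.part_eq_of_mem hV hi]
  have hNC : IsNoncrossing P := by
    intro V hV W hW i hi j hj k hk l hl hij hjk hkl
    have hik : r k = r i := (hP' V hV i hi k).1 hk
    have hjl : r l = r j := (hP' W hW j hj l).1 hl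
    -- Any crossing yields one of the restricted kind excluded by `h3`: for the pair k, l if the
    -- block of i has the smaller minimum, for the pair j, k if the block of j has.
    have : r j = r i := by
      rcases lt_trichotomy (r i) (r j) with h | h | h
      · exact absurd (lt_of_le_of_lt (hjl ▸ h1 j) hjk) (h3 k l hkl (by rw [hik, hjl]; exact h))
      · exact h.symm
      · exact absurd (lt_of_le_of_lt (hik ▸ h1 i) hij) (h3 j k hjk (by rw [hik]; exact h))
    exact P.eq_of_mem_parts hV hW ((hP' V hV i hi j).2 this) hj
  refine ⟨⟨P, hNC⟩, ?_⟩
  funext k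
  refine le_antisymm (blockMin_le _ ((hP _ _).2 (h2 k))) ?_
  have h4 : r (blockMin ⟨P, hNC⟩ k) = r k := (hP _ _).1 (blockMin_mem ⟨P, hNC⟩ k)
  rw [← h4]
  exact h1 _

theorem blockMin_mem_evenCodes {π : NC 8} (hπ : IsEven π) :
    blockMin π ∈ evenCodes.map codeFun := by
  -- The extension by the identity makes every point beyond 7 a singleton, so the hypotheses of
  -- `mem_ncCodes` hold on all of ℕ.
  let r : ℕ → ℕ := fun k => if h : k < 8 then blockMin π ⟨k, h⟩ else k
  have hr : ∀ k : Fin 8, r k = blockMin π k := fun k => dif_pos k.2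
  have hr' : ∀ k, ¬ k < 8 → r k = k := fun k hk => dif_neg hk
  have hmem : (List.range 8).map r ∈ ncCodes 8 := by
    refine mem_ncCodes r ?_ ?_ ?_ 8
    · intro k
      by_cases hk : k < 8
      · have := hr ⟨k, hk⟩
        rw [Fin.val_mk] at this
        rw [this]
        exact blockMin_le_self π ⟨k, hk⟩
      · rw [hr' k hk]
    · intro k
      by_cases hk : k < 8
      · have := hr ⟨k, hk⟩
        rw [Fin.val_mk] at this
        rw [this, hr, blockMin_blockMin]
      · rw [hr' k hk, hr' k hk]
    · intro j k hjk h h'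
      by_cases hk : k < 8
      · have hj : j < 8 := hjk.trans hk
        have e1 := hr ⟨j, hj⟩
        have e2 := hr ⟨k, hk⟩
        rw [Fin.val_mk] at e1 e2
        rw [e1, e2] at h
        rw [e2] at h'
        exact not_blockMin_crossing π (j := ⟨j, hj⟩) (k := ⟨k, hk⟩) hjk h h'
      · rw [hr' k hk] at h'
        omega
  have hfun : codeFun ((List.range 8).map r) = blockMin π := by
    funext k
    have : ((List.range 8).map r).getD k 0 = blockMin π k := by
      rw [← hr]
      simp [List.getD_eq_getElem?_getD]
    rw [codeFun, this]
    exact Fin.ofNat_val_eq_self _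
  rw [List.mem_map]
  refine ⟨_, ?_, hfun⟩
  rw [← filter_ncCodes_eight, List.mem_filter]
  refine ⟨hmem, ?_⟩
  rw [evenCounts, List.all_eq_true]
  intro v hv
  rw [List.mem_range] at hv
  have h1 : ((List.range 8).map r).countP (fun u => Nat.beq u v) =
      (Finset.univ.filter fun j => blockMin π j = ⟨v, hv⟩).card := by
    have h2 : (List.range 8).map r = (List.finRange 8).map fun k => (blockMin π k : ℕ) := by
      rw [← List.map_coe_finRange_eq_range, List.map_map]
      exact List.map_congr_left fun k _ => hr k
    rw [h2, List.countP_map, List.countP_eq_length_filter,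
      ← List.toFinset_card_of_nodup ((List.nodup_finRange 8).filter _)]
    congr 1
    ext j
    simp [Fin.ext_iff]
  rw [h1]
  have := (isEven_iff_blockMin π).1 hπ ⟨v, hv⟩
  exact Nat.beq_eq.mpr (Nat.even_iff.1 this)

open scoped Classical in
theorem image_blockMin_even :
    (Finset.univ.filter fun π : NC 8 => IsEven π).image blockMin =
      (evenCodes.map codeFun).toFinset := by
  ext r
  rw [Finset.mem_image, List.mem_toFinset]
  constructor
  · rintro ⟨π, hπ, rfl⟩
    exact blockMin_mem_evenCodes (Finset.mem_filter.1 hπ).2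
  · intro h
    obtain ⟨l, hl, rfl⟩ := List.mem_map.1 h
    obtain ⟨h1, h2, h3, h4⟩ := codeFun_spec l hl
    obtain ⟨π, hπ⟩ := exists_blockMin_eq _ h1 h2 h3
    refine ⟨π, Finset.mem_filter.2 ⟨Finset.mem_univ _, ?_⟩, hπ⟩
    rw [isEven_iff_blockMin, hπ]
    exact h4

open scoped Classical in
theorem sum_even_eq {R : Type*} [AddCommMonoid R] (f : (Fin 8 → Fin 8) → R) :
    ∑ π : NC 8 with IsEven π, f (blockMin π) = (evenCodes.map fun l => f (codeFun l)).sum := by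
  rw [← Finset.sum_image (f := f) blockMin_injective.injOn, image_blockMin_even,
    List.sum_toFinset _ nodup_map_codeFun, List.map_map]
  rfl

/-! ### The cumulant formula -/

/-- The free cumulants of the sum of two free generators and their inverses, up to order `8`. -/
def freeCumulant : ℕ → ℤ
  | 2 => 4
  | 4 => -4
  | 6 => 8
  | 8 => -20
  | _ => 0

/-- The size of the fibre of `r` over `k`. -/
def fibreCard (r : Fin 8 → Fin 8) (k : Fin 8) : ℕ := (List.finRange 8).countP fun j => r j = k

/-- The number of fixed points of `r`, that is, of blocks if `r` maps each element to the minimum of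
its block. -/
def fixedCard (r : Fin 8 → Fin 8) : ℕ := (List.finRange 8).countP fun j => r j = j

/-- The trace of the operator valued cumulant of `x` for a partition with block minima `r`. -/
def cumulant (r : Fin 8 → Fin 8) : ℤ :=
  ((List.finRange 8).map fun k => if r k = k then freeCumulant (fibreCard r k) else 1).prod +
    (if fixedCard r = 1 then -8 else 0) +
    if fixedCard r = 2 ∧ fibreCard r 0 = 4 then 2 else 0

/-- The moment computed symbolically. -/
def moment (r : Fin 8 → Fin 8) : ℕ := (symMoment r).getD 0

/-- The evaluator never meets a case without a rule, so the default value 0 in `moment` is never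
used. -/
theorem isSome_symMoment : ∀ l ∈ evenCodes, (symMoment (codeFun l)).isSome = true := by
  decide +kernel

/-- The moment-cumulant relation. The correction 2 accounts for 786 − 28² on each partition into two
blocks of size 4. There are four of these, and the −8 on the one-block partition cancels them, since
τ(x⁸) = 2092 is the free moment. -/
theorem sum_cumulant : ∀ l ∈ evenCodes,
    (evenCodes.map fun m => if ∀ k, codeFun l (codeFun m k) = codeFun l k then
      cumulant (codeFun m) else 0).sum = moment (codeFun l) := by
  decide +kernel

theorem sum_two_pow_mul_cumulant :
    (evenCodes.map fun l => 2 ^ fixedCard (codeFun l) * cumulant (codeFun l)).sum = 44264 := by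
  decide +kernel

theorem trace_psi_of_isEven {π : NC 8} (hπ : IsEven π) :
    trace (psi π) = (moment (blockMin π) : ℕ) := by
  refine trace_psi_of_symMoment π (blockMin π) (blockMin_eq_iff π) ?_
  obtain ⟨l, hl, h⟩ := List.mem_map.1 (blockMin_mem_evenCodes hπ)
  rw [moment, ← h]
  obtain ⟨m, hm⟩ := Option.isSome_iff_exists.1 (isSome_symMoment l hl)
  rw [hm, Option.getD_some]

open scoped Classical in
/-- Möbius inversion over an upper set of a finite partially ordered set. -/
theorem sum_mu_mul_of_isUpperSet {α R : Type*} [PartialOrder α] [Fintype α] [LocallyFiniteOrder α]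
    [CommRing R] (p : α → Prop) (hp : ∀ a b, a ≤ b → p a → p b) (f g : α → R)
    (h : ∀ b, p b → ∑ a with p a ∧ a ≤ b, f a = g b) (c : α) (hc : p c) :
    ∑ b with p b ∧ b ≤ c, IncidenceAlgebra.mu R b c * g b = f c := by
  have h1 : ∀ b ∈ Finset.univ.filter (fun b => p b ∧ b ≤ c), IncidenceAlgebra.mu R b c * g b =
      ∑ a with p a ∧ a ≤ c, if a ≤ b then IncidenceAlgebra.mu R b c * f a else 0 := by
    intro b hb
    simp only [Finset.mem_filter, Finset.mem_univ, true_and] at hb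
    rw [← h b hb.1, Finset.mul_sum, ← Finset.sum_filter, Finset.filter_filter]
    refine Finset.sum_congr ?_ fun _ _ => rfl
    ext a
    simp only [Finset.mem_filter, Finset.mem_univ, true_and]
    exact ⟨fun ha => ⟨⟨ha.1, ha.2.trans hb.2⟩, ha.2⟩, fun ha => ⟨ha.1.1, ha.2⟩⟩
  rw [Finset.sum_congr rfl h1, Finset.sum_comm]
  have h2 : ∀ a ∈ Finset.univ.filter (fun a => p a ∧ a ≤ c),
      (∑ b with p b ∧ b ≤ c, if a ≤ b then IncidenceAlgebra.mu R b c * f a else 0) =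
        if a = c then f a else 0 := by
    intro a ha
    simp only [Finset.mem_filter, Finset.mem_univ, true_and] at ha
    -- The whole interval from a to c satisfies p because a does, so the restricted sum of the
    -- Möbius function is its full interval sum.
    have h3 : (Finset.univ.filter fun b => p b ∧ b ≤ c).filter (fun b => a ≤ b) =
        Finset.Icc a c := by
      ext b
      simp only [Finset.mem_filter, Finset.mem_univ, true_and, Finset.mem_Icc]
      exact ⟨fun hb => ⟨hb.2, hb.1.2⟩, fun hb => ⟨⟨hp a b hb.1 ha.1, hb.2⟩, hb.1⟩⟩
    rw [← Finset.sum_filter, h3, ← Finset.sum_mul, IncidenceAlgebra.sum_Icc_mu_left, ite_mul,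
      one_mul, zero_mul]
  rw [Finset.sum_congr rfl h2, Finset.sum_ite_eq', if_pos]
  simp [hc]

theorem fixedCard_blockMin (π : NC 8) : fixedCard (blockMin π) = π.1.parts.card := by
  rw [card_parts, fixedCard, List.countP_eq_length_filter,
    ← List.toFinset_card_of_nodup ((List.nodup_finRange 8).filter _)]
  congr 1
  ext j
  simp

open scoped Classical in
theorem sum_cumulant_blockMin {σ : NC 8} (hσ : IsEven σ) :
    ∑ θ : NC 8 with IsEven θ ∧ θ ≤ σ, (cumulant (blockMin θ) : ℂ) = trace (psi σ) := by
  obtain ⟨l, hl, h⟩ := List.mem_map.1 (blockMin_mem_evenCodes hσ)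
  rw [trace_psi_of_isEven hσ, ← Finset.filter_filter, Finset.sum_filter]
  simp only [le_iff_blockMin, ← h]
  have h1 := sum_even_eq fun r => if ∀ k, codeFun l (r k) = codeFun l k then cumulant r else 0
  rw [sum_cumulant l hl] at h1
  have h2 := congrArg (Int.cast (R := ℂ)) h1
  rw [Int.cast_sum, Int.cast_natCast] at h2
  rw [← h2]
  refine Finset.sum_congr rfl fun θ _ => ?_
  split_ifs <;> simp

open scoped Classical in
theorem cumulant_formula :
    ∑ θ : NC 8 with IsEven θ, 2 ^ θ.1.parts.card *
      ∑ π : NC 8 with IsEven π ∧ π ≤ θ, moebius π θ * trace (psi π) = 44264 := by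
  have h1 : ∀ θ ∈ Finset.univ.filter (fun θ : NC 8 => IsEven θ), (2 ^ θ.1.parts.card *
      ∑ π : NC 8 with IsEven π ∧ π ≤ θ, moebius π θ * trace (psi π) : ℂ) =
      ((2 ^ fixedCard (blockMin θ) * cumulant (blockMin θ) : ℤ) : ℂ) := by
    intro θ hθ
    have hθ' : IsEven θ := (Finset.mem_filter.1 hθ).2
    -- Inversion identifies the inner sum over π with the explicit cumulant of θ, leaving only an
    -- integer sum over the list of codes.
    have h2 := sum_mu_mul_of_isUpperSet (R := ℂ) (fun π : NC 8 => IsEven π)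
      (fun _ _ h hπ => IsEven.mono h hπ) (fun π => (cumulant (blockMin π) : ℂ))
      (fun π => trace (psi π)) (fun σ hσ => sum_cumulant_blockMin hσ) θ hθ'
    rw [fixedCard_blockMin, Int.cast_mul, ← h2]
    push_cast
    refine congrArg _ (Finset.sum_congr rfl fun π _ => ?_)
    rw [moebius]
    congr!
  rw [Finset.sum_congr rfl h1, ← Int.cast_sum,
    sum_even_eq fun r => 2 ^ fixedCard r * cumulant r, sum_two_pow_mul_cumulant]
  norm_num

end FreeAmalgam

end

theorem mainTheorem4 :
    -- the eighth moment of `x + y`, directly and through the conditional expectation onto `L(F₁)`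
    FreeAmalgam.trace ((FreeAmalgam.xElt + FreeAmalgam.yElt) ^ 8) = 44264 ∧
    FreeAmalgam.trace (FreeAmalgam.incl FreeAmalgam.amalgSubgroup
      (FreeAmalgam.amalgExp ((FreeAmalgam.xElt + FreeAmalgam.yElt) ^ 8))) = 44264 ∧
    -- the cumulant formula
    (open scoped Classical in
      ∑ θ : FreeAmalgam.NC 8 with FreeAmalgam.IsEven θ, 2 ^ θ.1.parts.card *
        ∑ π : FreeAmalgam.NC 8 with FreeAmalgam.IsEven π ∧ π ≤ θ,
          FreeAmalgam.moebius π θ * FreeAmalgam.trace (FreeAmalgam.psi π)) = 44264 ∧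
    -- the count in the free group on four generators, corrected by the surface relator
    FreeAmalgam.trace ((FreeAmalgam.xElt + FreeAmalgam.yElt) ^ 8) =
      FreeAmalgam.trace (FreeAmalgam.freeSum ^ 8) + (FreeAmalgam.surfaceWords 8).ncard ∧
    FreeAmalgam.trace (FreeAmalgam.freeSum ^ 8) = 44248 ∧
    FreeAmalgam.surfaceWords 8 =
      {w | List.IsRotated w FreeAmalgam.relator ∨
        List.IsRotated w (FreeGroup.invRev FreeAmalgam.relator)} ∧
    (FreeAmalgam.surfaceWords 8).ncard = 16 := by
  refine ⟨FreeAmalgam.trace_surface, ?_, ?_, ?_, FreeAmalgam.trace_freeSum,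
    FreeAmalgam.surfaceWords_eight, FreeAmalgam.ncard_surfaceWords_eight⟩
  · rw [FreeAmalgam.amalgExp, FreeAmalgam.trace_incl_condExp, FreeAmalgam.trace_surface]
  · exact FreeAmalgam.cumulant_formula
  · rw [FreeAmalgam.trace_surface, FreeAmalgam.trace_freeSum,
      FreeAmalgam.ncard_surfaceWords_eight]
    norm_num
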